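/- **Lemma (equivalence of matrix sparsification and sparse null space).** All matrices are over $\mathbb{Q}$, of arbitrary finite size (empty matrices allowed), and $\mathrm{nnz}(N)$ is the number of nonzero entries of $N$. An $m\times n$ matrix is *full rank* if its columns are linearly independent. An $n\times k$ matrix $N$ is a *full null matrix* for an $m\times n$ matrix $A$ if $N$ is full rank and its columns span the null space $\{b\in\mathbb{Q}^n : Ab=0\}$. A minimization problem $F$ consists of a set $\mathcal{I}_F$ of instances, a solution space $S_F(x)$ for each $x\in\mathcal{I}_F$, and an objective $M_F(x,y)$ for $y\in S_F(x)$, to be minimized over $y$; write $\|F(x)\| = \min_{y\in S_F(x)} M_F(x,y)$. * Sparse null space (SNS): the instances are all matrices $A$; $S_{\mathsf{SNS}}(A)$ is the set of full null matrices for $A$; $M_{\mathsf{SNS}}(A,N)=\mathrm{nnz}(N)$. * Matrix sparsification (MS): the instances are all full rank matrices $B$; $S_{\mathsf{MS}}(B)=\{BX : X \text{ an invertible matrix}\}$; $M_{\mathsf{MS}}(B,N)=\mathrm{nnz}(N)$. An *exact reduction* from $F$ to $G$ is a pair $\langle t_1,t_2\rangle$ of functions such that 1. $t_1$ and $t_2$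 are computable in polynomial time, measured in bit operations in the bit length of the input (a rational entry is given by its reduced numerator and denominator in binary, the two dimensions of a matrix in unary); 2. $t_1$ maps $\mathcal{I}_F$ to $\mathcal{I}_G$, and $t_2(x,y)\in S_F(x)$ for all $x\in\mathcal{I}_F$ and $y\in S_G(t_1(x))$; 3. $M_F(x,t_2(x,y)) = M_G(t_1(x),y)$ for all $x\in\mathcal{I}_F$ and $y\in S_G(t_1(x))$; 4. $\|F(x)\|\ge \|G(t_1(x))\|$ for all $x\in\mathcal{I}_F$. Two problems $F$ and $G$ are *equivalent* if there are an exact reduction from $F$ to $G$ and an exact reduction from $G$ to $F$. Then matrix sparsification and sparse null space are equivalent. -/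

import Mathlib

namespace SparseMat

/-! ### A random access machine with logarithmic cost

Programs act on integer variables and on integer arrays (random access memory with indirect
addressing). Every value that is read, written or computed, addresses included, is charged its bit
length, so cost is measured in bits and not in arithmetic operations. -/

/-- Length of the binary notation of an integer, with one extra bit for the sign. -/
def bitLen (z : ℤ) : ℕ := z.natAbs.size + 1

/-- The memory: variables and arrays, each family indexed by `ℕ`; array cells have integer
addresses. A program mentions only finitely many of the variables and arrays. -/
@[ext] structure Store where
  var : ℕ → ℤ
  arr : ℕ → ℤ → ℤ

/-- Arithmetic expressions; `div` is the integer quotient. -/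
inductive Exp where
  | const (z : ℤ)
  | var (x : ℕ)
  | read (a : ℕ) (i : Exp)
  | add (e₁ e₂ : Exp)
  | sub (e₁ e₂ : Exp)
  | mul (e₁ e₂ : Exp)
  | div (e₁ e₂ : Exp)

/-- Value of an expression. -/
def Exp.eval (s : Store) : Exp → ℤ
  | const z => z
  | var x => s.var x
  | read a i => s.arr a (i.eval s)
  | add e₁ e₂ => e₁.eval s + e₂.eval s
  | sub e₁ e₂ => e₁.eval s - e₂.eval s
  | mul e₁ e₂ => e₁.eval s * e₂.eval s
  | div e₁ e₂ => e₁.eval s / e₂.eval s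

/-- Cost of evaluating an expression: the bit lengths of all values that occur on the way. -/
def Exp.cost (s : Store) : Exp → ℕ
  | const z => bitLen z
  | var x => bitLen (s.var x)
  | read a i => i.cost s + bitLen (s.arr a (i.eval s))
  | add e₁ e₂ => e₁.cost s + e₂.cost s + bitLen (e₁.eval s + e₂.eval s)
  | sub e₁ e₂ => e₁.cost s + e₂.cost s + bitLen (e₁.eval s - e₂.eval s)
  | mul e₁ e₂ => e₁.cost s + e₂.cost s + bitLen (e₁.eval s * e₂.eval s)
  | div e₁ e₂ => e₁.cost s + e₂.cost s + bitLen (e₁.eval s / e₂.eval s)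

/-- Programs. `ite e c₁ c₂` runs `c₁` if `e` is positive and `c₂` otherwise; `loop e c` runs `c`
as long as `e` is positive. -/
inductive Prog where
  | skip
  | assign (x : ℕ) (e : Exp)
  | write (a : ℕ) (i e : Exp)
  | seq (c₁ c₂ : Prog)
  | ite (e : Exp) (c₁ c₂ : Prog)
  | loop (e : Exp) (c : Prog)

/-- `Exec c s s' t`: started in the store `s`, the program `c` halts in the store `s'`, at total
cost `t`. -/
inductive Exec : Prog → Store → Store → ℕ → Prop where
  | skip (s : Store) : Exec .skip s s 1
  | assign (x : ℕ) (e : Exp) (s : Store) :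
      Exec (.assign x e) s { s with var := Function.update s.var x (e.eval s) } (e.cost s + 1)
  | write (a : ℕ) (i e : Exp) (s : Store) :
      Exec (.write a i e) s
        { s with arr := Function.update s.arr a
                          (Function.update (s.arr a) (i.eval s) (e.eval s)) }
        (i.cost s + e.cost s + 1)
  | seq {c₁ c₂ : Prog} {s s' s'' : Store} {t₁ t₂ : ℕ}
      (h₁ : Exec c₁ s s' t₁) (h₂ : Exec c₂ s' s'' t₂) : Exec (.seq c₁ c₂) s s'' (t₁ + t₂)
  | ite_pos {e : Exp} {c₁ c₂ : Prog} {s s' : Store} {t : ℕ}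
      (he : 0 < e.eval s) (h : Exec c₁ s s' t) : Exec (.ite e c₁ c₂) s s' (e.cost s + 1 + t)
  | ite_neg {e : Exp} {c₁ c₂ : Prog} {s s' : Store} {t : ℕ}
      (he : ¬ 0 < e.eval s) (h : Exec c₂ s s' t) : Exec (.ite e c₁ c₂) s s' (e.cost s + 1 + t)
  | loop_pos {e : Exp} {c : Prog} {s s' s'' : Store} {t₁ t₂ : ℕ}
      (he : 0 < e.eval s) (h₁ : Exec c s s' t₁) (h₂ : Exec (.loop e c) s' s'' t₂) :
      Exec (.loop e c) s s'' (e.cost s + 1 + t₁ + t₂)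
  | loop_neg {e : Exp} {c : Prog} {s : Store}
      (he : ¬ 0 < e.eval s) : Exec (.loop e c) s s (e.cost s + 1)

/-- The initial store on the input words `ws`: the `i`-th word stands in array `i` at the addresses
`0, 1, …`, its length in variable `i`; everything else is `0`. -/
def Store.init (ws : List (List ℤ)) : Store where
  var i := ((ws.getD i []).length : ℤ)
  arr i j := if 0 ≤ j then (ws.getD i []).getD j.toNat 0 else 0

/-- The output word of a final store is `w`: its length stands in variable `0` and its letters in
array `0` at the addresses `0, 1, …`. -/
def Store.Outputs (s : Store) (w : List ℤ) : Prop :=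
  s.var 0 = (w.length : ℤ) ∧ ∀ j : ℕ, j < w.length → s.arr 0 (j : ℤ) = w.getD j 0

/-- Bit size of a word of integers. -/
def wordSize (w : List ℤ) : ℕ := (w.map bitLen).sum

/-- A function, given on encodings of inputs (each a list of words) and outputs, is computable in
polynomial time: one program computes it on all inputs, at a cost polynomial in the bit size of the
input. -/
def PolyTime {α β : Type} (encIn : α → List (List ℤ)) (encOut : β → List ℤ) (f : α → β) : Prop :=
  ∃ (c : Prog) (p : Polynomial ℕ), ∀ a : α, ∃ (s : Store) (t : ℕ),
    Exec c (Store.init (encIn a)) s t ∧ t ≤ p.eval ((encIn a).map wordSize).sum ∧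
      s.Outputs (encOut (f a))

/-! ### Optimization problems and exact reductions -/

/-- A minimization problem: instances and solution candidates with their encodings as words, the
solution space of each instance, and the objective. -/
structure MinProblem where
  Inst : Type
  Sol : Type
  encInst : Inst → List ℤ
  encSol : Sol → List ℤ
  encInst_injective : Function.Injective encInst
  encSol_injective : Function.Injective encSol
  S : Inst → Set Sol
  M : Inst → Sol → ℕ

/-- The optimal value of an instance (`⊤` if there is no solution). -/
noncomputable def MinProblem.opt (F : MinProblem) (x : F.Inst) : ℕ∞ :=
  ⨅ y ∈ F.S x, (F.M x y : ℕ∞)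

/-- The pair `(t₁, t₂)` is an exact reduction from `F` to `G`. -/
structure IsExactReduction (F G : MinProblem) (t₁ : F.Inst → G.Inst)
    (t₂ : F.Inst × G.Sol → F.Sol) : Prop where
  polyTime_fst : PolyTime (fun x => [F.encInst x]) G.encInst t₁
  polyTime_snd : PolyTime (fun p => [F.encInst p.1, G.encSol p.2]) F.encSol t₂
  mapsTo : ∀ x, ∀ y ∈ G.S (t₁ x), t₂ (x, y) ∈ F.S x
  objective_eq : ∀ x, ∀ y ∈ G.S (t₁ x), F.M x (t₂ (x, y)) = G.M (t₁ x) y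
  opt_le : ∀ x, G.opt (t₁ x) ≤ F.opt x

/-- `F` reduces exactly to `G`. -/
def ExactlyReducible (F G : MinProblem) : Prop :=
  ∃ t₁ t₂, IsExactReduction F G t₁ t₂

/-- Equivalence of minimization problems. -/
def Equivalent (F G : MinProblem) : Prop :=
  ExactlyReducible F G ∧ ExactlyReducible G F

/-! ### Rational matrices and the two problems -/

/-- A rational matrix of arbitrary size; empty matrices are allowed. -/
structure RatMatrix where
  rows : ℕ
  cols : ℕ
  entries : Matrix (Fin rows) (Fin cols) ℚ

/-- Encoding of a matrix: the two dimensions in unary, each closed by a `0`, and then the entries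
row by row, each as its numerator and its denominator. -/
def RatMatrix.code (A : RatMatrix) : List ℤ :=
  List.replicate A.rows 1 ++ 0 :: (List.replicate A.cols 1 ++ 0 ::
    (List.finRange A.rows).flatMap fun i => (List.finRange A.cols).flatMap fun j =>
      [(A.entries i j).num, ((A.entries i j).den : ℤ)])

theorem replicate_append_zero_inj {m n : ℕ} {u v : List ℤ}
    (h : List.replicate m 1 ++ 0 :: u = List.replicate n 1 ++ 0 :: v) : m = n ∧ u = v := by
  induction m generalizing n with
  | zero => cases n <;> simp_all [List.replicate_succ]
  | succ m ih =>
    cases n with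
    | zero => simp [List.replicate_succ] at h
    | succ n =>
      simp only [List.replicate_succ, List.cons_append, List.cons.injEq, true_and] at h
      obtain ⟨h₁, h₂⟩ := ih h
      exact ⟨by rw [h₁], h₂⟩

theorem flatMap_inj_of_length {ι : Type} {k : ℕ} (l : List ι) (f g : ι → List ℤ)
    (hf : ∀ i, (f i).length = k) (hg : ∀ i, (g i).length = k)
    (h : l.flatMap f = l.flatMap g) : ∀ i ∈ l, f i = g i := by
  induction l with
  | nil => simp
  | cons a l ih =>
    simp only [List.flatMap_cons] at h
    obtain ⟨h₁, h₂⟩ := List.append_inj h (by rw [hf, hg])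
    intro i hi
    rcases List.mem_cons.1 hi with rfl | hi
    · exact h₁
    · exact ih h₂ i hi

theorem RatMatrix.code_injective : Function.Injective RatMatrix.code := by
  rintro ⟨m, n, A⟩ ⟨m', n', B⟩ h
  simp only [RatMatrix.code] at h
  obtain ⟨rfl, h⟩ := replicate_append_zero_inj h
  obtain ⟨rfl, h⟩ := replicate_append_zero_inj h
  congr 1
  ext i j
  have h₁ := flatMap_inj_of_length (k := n * 2) _ _ _ (by simp [List.length_flatMap])
    (by simp [List.length_flatMap]) h i (List.mem_finRange i)
  have h₂ := flatMap_inj_of_length (k := 2) _ _ _ (by simp) (by simp) h₁ j (List.mem_finRange j)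
  simp only [List.cons.injEq, and_true] at h₂
  exact Rat.ext h₂.1 (by exact_mod_cast h₂.2)

/-- Number of nonzero entries. -/
def RatMatrix.nnz (A : RatMatrix) : ℕ :=
  (Finset.univ.filter fun ij : Fin A.rows × Fin A.cols => A.entries ij.1 ij.2 ≠ 0).card

/-- `A` is full rank: its columns are linearly independent. -/
def RatMatrix.FullRank (A : RatMatrix) : Prop :=
  LinearIndependent ℚ A.entries.col

/-- `N` is a full null matrix for `A`: it is full rank and its columns span the null space of
`A`. -/
def IsFullNullMatrix {m n k : ℕ} (A : Matrix (Fin m) (Fin n) ℚ) (N : Matrix (Fin n) (Fin k) ℚ) :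
    Prop :=
  LinearIndependent ℚ N.col ∧
    Submodule.span ℚ (Set.range N.col) = LinearMap.ker A.mulVecLin

/-- Sparse null space: given any matrix `A`, find a full null matrix for `A` with as few nonzero
entries as possible. -/
def sparseNullSpace : MinProblem where
  Inst := RatMatrix
  Sol := RatMatrix
  encInst := RatMatrix.code
  encSol := RatMatrix.code
  encInst_injective := RatMatrix.code_injective
  encSol_injective := RatMatrix.code_injective
  S A := {N | ∃ (k : ℕ) (N₀ : Matrix (Fin A.cols) (Fin k) ℚ),
    N = ⟨A.cols, k, N₀⟩ ∧ IsFullNullMatrix A.entries N₀}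
  M _ N := N.nnz

/-- Matrix sparsification: given a full rank matrix `B`, find a matrix of the form `B X`, with `X`
invertible, with as few nonzero entries as possible. -/
def matrixSparsification : MinProblem where
  Inst := {B : RatMatrix // B.FullRank}
  Sol := RatMatrix
  encInst B := B.1.code
  encSol := RatMatrix.code
  encInst_injective := RatMatrix.code_injective.comp Subtype.val_injective
  encSol_injective := RatMatrix.code_injective
  S B := {N | ∃ X : Matrix (Fin B.1.cols) (Fin B.1.cols) ℚ,
    IsUnit X ∧ N = ⟨B.1.rows, B.1.cols, B.1.entries * X⟩}
  M _ N := N.nnz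

end SparseMat

namespace SparseMat

/-! Any two full null matrices of `A` have the same column space, so they differ by an invertible
factor on the right (`IsFullNullMatrix.mul_isUnit`, `IsFullNullMatrix.exists_eq_mul`). Hence the
solutions of SNS on `A` are those of MS on any one full null matrix of `A`. Conversely, if the null
space of `N₀` is the column space of a full rank `B`, then `B` is a full null matrix for `N₀`, and
MS on `B` has the solutions of SNS on `N₀`. In both directions `t₁` computes such a matrix.
Solutions and objectives then coincide, so `t₂` is the projection to the given solution and the
optima agree.

The work lies in computing these matrices in polynomial bit time. After clearing denominators the
equations are integer rows `w i`. A nonsingular integer matrix `M`, initially the identity, is kept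
only through its determinant and adjugate. If an equation is not orthogonal to some free column `k`
of the adjugate, it replaces row `k` of `M`, and `k` stops being free. The new adjugate comes from
the old one by an exact division (`det_mul_adjugate_updateRow`), so its entries are always minors
and the Leibniz formula bounds their bit length polynomially. In the end the free columns solve all
equations and the other rows of `M` are equations. The identity `det M • b = adj M * (M * b)` shows
that the free columns span the kernel, and its transposed form shows that the vectors orthogonal to
all free columns are combinations of the equations. The first serves SNS; the second, applied to the
columns of `B` as equations, serves MS.

For the cost, all values in memory are kept below `2 ^ L`; then a basic step costs `O(L)` bits and
it is enough to count steps (`Runs`). -/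

/-! ### Reasoning about programs and their cost -/

/-- Assignment to a variable. -/
def Store.setVar (s : Store) (x : ℕ) (v : ℤ) : Store :=
  { s with var := Function.update s.var x v }

/-- Assignment to an array cell. -/
def Store.setArr (s : Store) (a : ℕ) (i v : ℤ) : Store :=
  { s with arr := Function.update s.arr a (Function.update (s.arr a) i v) }

@[simp] theorem Store.var_setVar (s : Store) (x y : ℕ) (v : ℤ) :
    (s.setVar x v).var y = if y = x then v else s.var y := by
  simp [Store.setVar, Function.update_apply]

@[simp] theorem Store.arr_setVar (s : Store) (x : ℕ) (v : ℤ) : (s.setVar x v).arr = s.arr := rfl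

@[simp] theorem Store.var_setArr (s : Store) (a : ℕ) (i v : ℤ) : (s.setArr a i v).var = s.var := rfl

@[simp] theorem Store.arr_setArr (s : Store) (a b : ℕ) (i j v : ℤ) :
    (s.setArr a i v).arr b j = if b = a ∧ j = i then v else s.arr b j := by
  by_cases h : b = a
  · subst h; simp [Store.setArr, Function.update_apply]
  · simp [Store.setArr, h]

/-- All values in the store have absolute value at most `2 ^ L`. -/
def Store.Bounded (L : ℕ) (s : Store) : Prop :=
  (∀ x, |s.var x| ≤ 2 ^ L) ∧ ∀ a i, |s.arr a i| ≤ 2 ^ L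

theorem Store.Bounded.setVar {L : ℕ} {s : Store} (h : s.Bounded L) {x : ℕ} {v : ℤ}
    (hv : |v| ≤ 2 ^ L) : (s.setVar x v).Bounded L := by
  refine ⟨fun y => ?_, h.2⟩
  rw [Store.var_setVar]
  split_ifs
  exacts [hv, h.1 y]

theorem Store.Bounded.setArr {L : ℕ} {s : Store} (h : s.Bounded L) {a : ℕ} {i v : ℤ}
    (hv : |v| ≤ 2 ^ L) : (s.setArr a i v).Bounded L := by
  refine ⟨h.1, fun b j => ?_⟩
  rw [Store.arr_setArr]
  split_ifs
  exacts [hv, h.2 b j]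

/-- A size of expressions that controls their cost. -/
def Exp.weight : Exp → ℕ
  | const z => z.natAbs + 1
  | var _ => 1
  | read _ i => i.weight + 1
  | add e₁ e₂ => e₁.weight + e₂.weight + 1
  | sub e₁ e₂ => e₁.weight + e₂.weight + 1
  | mul e₁ e₂ => e₁.weight + e₂.weight + 1
  | div e₁ e₂ => e₁.weight + e₂.weight + 1

theorem abs_ediv_le_abs (a b : ℤ) : |a / b| ≤ |a| := by
  have := Int.natAbs_ediv_le_natAbs a b
  rw [Int.abs_eq_natAbs, Int.abs_eq_natAbs]
  exact_mod_cast this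

/-- Products add exponents, sums and differences need one more bit, quotients do not grow. The extra
`1` in the weight of each node, together with `1 ≤ L`, pays for that bit. Constants weigh more than
`|z|` because `|z| ≤ 2 ^ |z|`. -/
theorem Exp.abs_eval_le {L : ℕ} (hL : 1 ≤ L) {s : Store} (hs : s.Bounded L) (e : Exp) :
    |e.eval s| ≤ 2 ^ (L * e.weight) := by
  have key : ∀ {x y : ℤ} {a b : ℕ}, |x| ≤ 2 ^ (L * a) → |y| ≤ 2 ^ (L * b) →
      |x| + |y| ≤ 2 ^ (L * (a + b + 1)) := by
    intro x y a b hx hy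
    have h₁ : (2 : ℤ) ^ (L * a) ≤ 2 ^ (L * (a + b)) :=
      pow_le_pow_right₀ (by norm_num) (Nat.mul_le_mul_left _ (by omega))
    have h₂ : (2 : ℤ) ^ (L * b) ≤ 2 ^ (L * (a + b)) :=
      pow_le_pow_right₀ (by norm_num) (Nat.mul_le_mul_left _ (by omega))
    calc |x| + |y| ≤ 2 ^ (L * (a + b) + 1) := by rw [pow_succ]; linarith
      _ ≤ _ := pow_le_pow_right₀ (by norm_num) (by rw [mul_add L (a + b) 1]; omega)
  induction e with
  | const z =>
    simp only [Exp.eval, Exp.weight]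
    calc |z| = ((z.natAbs : ℕ) : ℤ) := Int.abs_eq_natAbs z
      _ ≤ 2 ^ z.natAbs := by exact_mod_cast Nat.lt_two_pow_self.le
      _ ≤ _ := pow_le_pow_right₀ (by norm_num)
          ((Nat.le_succ _).trans (Nat.le_mul_of_pos_left _ hL))
  | var x => simpa [Exp.eval, Exp.weight] using hs.1 x
  | read a i ih =>
    exact (hs.2 a _).trans (pow_le_pow_right₀ (by norm_num) (by simp only [Exp.weight]; nlinarith))
  | add e₁ e₂ h₁ h₂ => exact (abs_add_le _ _).trans (key h₁ h₂)
  | sub e₁ e₂ h₁ h₂ => exact (abs_sub _ _).trans (key h₁ h₂)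
  | mul e₁ e₂ h₁ h₂ =>
    simp only [Exp.eval, Exp.weight, abs_mul]
    calc _ ≤ (2 : ℤ) ^ (L * e₁.weight) * 2 ^ (L * e₂.weight) := by gcongr
      _ = 2 ^ (L * (e₁.weight + e₂.weight)) := by rw [← pow_add, mul_add]
      _ ≤ _ := pow_le_pow_right₀ (by norm_num) (by nlinarith)
  | div e₁ e₂ h₁ h₂ =>
    refine (abs_ediv_le_abs _ _).trans (h₁.trans (pow_le_pow_right₀ (by norm_num) ?_))
    simp only [Exp.weight]
    nlinarith

theorem bitLen_le {z : ℤ} {n : ℕ} (h : |z| ≤ 2 ^ n) : bitLen z ≤ n + 2 := by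
  have : z.natAbs < 2 ^ (n + 1) := by
    rw [Int.abs_eq_natAbs] at h
    have h' : z.natAbs ≤ 2 ^ n := by exact_mod_cast h
    have := Nat.pow_pos (n := n) (show 0 < 2 by norm_num)
    rw [pow_succ]; omega
  have := Nat.size_le.2 this
  unfold bitLen; omega

/-- There are at most `e.weight` nodes, each charged one bit length. The rate uses a fixed `W`, so
that it is the same for all subexpressions in the induction. -/
theorem Exp.cost_le {L : ℕ} (hL : 1 ≤ L) {s : Store} (hs : s.Bounded L) {W : ℕ} (e : Exp)
    (he : e.weight ≤ W) : e.cost s ≤ e.weight * (L * W + 2) := by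
  have key : ∀ e : Exp, e.weight ≤ W → bitLen (e.eval s) ≤ L * W + 2 := fun e he =>
    bitLen_le ((e.abs_eval_le hL hs).trans
      (pow_le_pow_right₀ (by norm_num) (Nat.mul_le_mul_left _ he)))
  induction e with
  | const z =>
    refine (key _ he).trans (Nat.le_mul_of_pos_left _ (by simp [Exp.weight]))
  | var x => simpa [Exp.weight, Exp.eval, Exp.cost] using key _ he
  | read a i ih =>
    have h := key _ he
    simp only [Exp.weight, Exp.eval, Exp.cost] at *
    have := ih (by omega)
    nlinarith
  | add e₁ e₂ h₁ h₂ | sub e₁ e₂ h₁ h₂ | mul e₁ e₂ h₁ h₂ | div e₁ e₂ h₁ h₂ =>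
    have h := key _ he
    simp only [Exp.weight, Exp.eval, Exp.cost] at *
    have := h₁ (by omega)
    have := h₂ (by omega)
    nlinarith

/-- The variables assigned by a program. -/
def Prog.modVars : Prog → List ℕ
  | skip => []
  | assign x _ => [x]
  | write _ _ _ => []
  | seq c₁ c₂ => c₁.modVars ++ c₂.modVars
  | ite _ c₁ c₂ => c₁.modVars ++ c₂.modVars
  | loop _ c => c.modVars

/-- The arrays written by a program. -/
def Prog.modArrs : Prog → List ℕ
  | skip => []
  | assign _ _ => []
  | write a _ _ => [a]
  | seq c₁ c₂ => c₁.modArrs ++ c₂.modArrs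
  | ite _ c₁ c₂ => c₁.modArrs ++ c₂.modArrs
  | loop _ c => c.modArrs

/-- The stores `s` and `s'` agree on all variables and arrays that `c` does not modify. -/
def Prog.Frame (c : Prog) (s s' : Store) : Prop :=
  (∀ x, x ∉ c.modVars → s'.var x = s.var x) ∧ ∀ a, a ∉ c.modArrs → s'.arr a = s.arr a

theorem Prog.Frame.refl (c : Prog) (s : Store) : c.Frame s s := ⟨fun _ _ => rfl, fun _ _ => rfl⟩

theorem Prog.Frame.trans {c : Prog} {s s' s'' : Store} (h : c.Frame s s') (h' : c.Frame s' s'') :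
    c.Frame s s'' :=
  ⟨fun x hx => (h'.1 x hx).trans (h.1 x hx), fun a ha => (h'.2 a ha).trans (h.2 a ha)⟩

theorem Prog.Frame.mono {c c' : Prog} {s s' : Store} (h : c.Frame s s')
    (hv : c.modVars ⊆ c'.modVars) (ha : c.modArrs ⊆ c'.modArrs) : c'.Frame s s' :=
  ⟨fun x hx => h.1 x fun hx' => hx (hv hx'), fun a ha' => h.2 a fun hx' => ha' (ha hx')⟩

theorem Exec.frame {c : Prog} {s s' : Store} {t : ℕ} (h : Exec c s s' t) : c.Frame s s' := by
  induction h with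
  | skip s => exact .refl _ _
  | assign x e s =>
    refine ⟨fun y hy => ?_, fun _ _ => rfl⟩
    simp only [Prog.modVars, List.mem_singleton] at hy
    simp [hy]
  | write a i e s =>
    refine ⟨fun _ _ => rfl, fun b hb => ?_⟩
    simp only [Prog.modArrs, List.mem_singleton] at hb
    simp [hb]
  | seq _ _ ih₁ ih₂ =>
    exact (ih₁.mono (by simp [Prog.modVars]) (by simp [Prog.modArrs])).trans
      (ih₂.mono (by simp [Prog.modVars]) (by simp [Prog.modArrs]))
  | ite_pos _ _ ih => exact ih.mono (by simp [Prog.modVars]) (by simp [Prog.modArrs])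
  | ite_neg _ _ ih => exact ih.mono (by simp [Prog.modVars]) (by simp [Prog.modArrs])
  | loop_pos _ _ _ ih₁ ih₂ =>
    exact Prog.Frame.trans (c := .loop _ _) ⟨ih₁.1, ih₁.2⟩ ih₂
  | loop_neg _ => exact .refl _ _

/-- The maximal weight of the expressions in the programs below. -/
abbrev maxWeight : ℕ := 60

/-- Cost of a basic step in a store bounded by `2 ^ L`. -/
def stepCost (L : ℕ) : ℕ := 2 * (maxWeight * (L * maxWeight + 2)) + 1

/-- Started in `s`, the program `c` makes at most `T` basic steps, keeps all values bounded by
`2 ^ L`, and halts in a store with property `Q`. -/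
def Runs (L : ℕ) (c : Prog) (s : Store) (T : ℕ) (Q : Store → Prop) : Prop :=
  s.Bounded L → ∃ s' t, Exec c s s' t ∧ t ≤ T * stepCost L ∧ s'.Bounded L ∧ Q s'

namespace Runs

variable {L : ℕ}

/-- The consequence rule hands over the frame property and boundedness of the final store, so
postconditions only have to mention what a program changes. -/
theorem mono {c : Prog} {s : Store} {T T' : ℕ} {Q Q' : Store → Prop} (h : Runs L c s T Q)
    (hT : T ≤ T') (hQ : ∀ s', c.Frame s s' → s'.Bounded L → Q s' → Q' s') : Runs L c s T' Q' := by
  intro hs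
  obtain ⟨s', t, h₁, h₂, h₃, h₄⟩ := h hs
  exact ⟨s', t, h₁, h₂.trans (Nat.mul_le_mul_right _ hT), h₃, hQ s' h₁.frame h₃ h₄⟩

theorem cost_le (hL : 1 ≤ L) {s : Store} (hs : s.Bounded L) {e : Exp}
    (he : e.weight ≤ maxWeight) : e.cost s ≤ maxWeight * (L * maxWeight + 2) :=
  (e.cost_le hL hs he).trans (Nat.mul_le_mul_right _ he)

theorem skip {s : Store} {Q : Store → Prop} (hQ : Q s) : Runs L .skip s 1 Q := by
  intro hs
  exact ⟨s, 1, .skip s, by unfold stepCost; omega, hs, hQ⟩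

theorem assign (hL : 1 ≤ L) {x : ℕ} {e : Exp} {s : Store} {Q : Store → Prop}
    (he : e.weight ≤ maxWeight) (hb : |e.eval s| ≤ 2 ^ L) (hQ : Q (s.setVar x (e.eval s))) :
    Runs L (.assign x e) s 1 Q := by
  intro hs
  have := cost_le hL hs he
  exact ⟨_, _, .assign x e s, by unfold stepCost; omega, hs.setVar hb, hQ⟩

/-- A write evaluates two expressions, whence the factor `2` in `stepCost`. -/
theorem write (hL : 1 ≤ L) {a : ℕ} {i e : Exp} {s : Store} {Q : Store → Prop}
    (hi : i.weight ≤ maxWeight) (he : e.weight ≤ maxWeight) (hb : |e.eval s| ≤ 2 ^ L)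
    (hQ : Q (s.setArr a (i.eval s) (e.eval s))) : Runs L (.write a i e) s 1 Q := by
  intro hs
  have := cost_le hL hs he
  have := cost_le hL hs hi
  exact ⟨_, _, .write a i e s, by unfold stepCost; omega, hs.setArr hb, hQ⟩

theorem seq {c₁ c₂ : Prog} {s : Store} {T₁ T₂ : ℕ} {Q : Store → Prop}
    (h : Runs L c₁ s T₁ fun s' => Runs L c₂ s' T₂ Q) : Runs L (.seq c₁ c₂) s (T₁ + T₂) Q := by
  intro hs
  obtain ⟨s₁, t₁, h₁, h₂, h₃, h₄⟩ := h hs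
  obtain ⟨s₂, t₂, h₅, h₆, h₇, h₈⟩ := h₄ h₃
  exact ⟨s₂, _, .seq h₁ h₅, by rw [add_mul]; omega, h₇, h₈⟩

theorem ite (hL : 1 ≤ L) {e : Exp} {c₁ c₂ : Prog} {s : Store} {T : ℕ} {Q : Store → Prop}
    (he : e.weight ≤ maxWeight) (h₁ : 0 < e.eval s → Runs L c₁ s T Q)
    (h₂ : ¬ 0 < e.eval s → Runs L c₂ s T Q) : Runs L (.ite e c₁ c₂) s (1 + T) Q := by
  intro hs
  have := cost_le hL hs he
  by_cases h : 0 < e.eval s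
  · obtain ⟨s', t, h₃, h₄, h₅⟩ := h₁ h hs
    exact ⟨s', _, .ite_pos h h₃, by rw [add_mul]; unfold stepCost at *; omega, h₅⟩
  · obtain ⟨s', t, h₃, h₄, h₅⟩ := h₂ h hs
    exact ⟨s', _, .ite_neg h h₃, by rw [add_mul]; unfold stepCost at *; omega, h₅⟩

/-- The invariant is indexed by the round and fixes the number of rounds in advance, so termination
needs no separate argument. -/
theorem loop (hL : 1 ≤ L) {e : Exp} {c : Prog} {s : Store} {T n : ℕ}
    (I : ℕ → Store → Prop) (he : e.weight ≤ maxWeight) (h0 : I 0 s)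
    (hpos : ∀ i < n, ∀ s', c.Frame s s' → I i s' →
      0 < e.eval s' ∧ Runs L c s' T (I (i + 1)))
    (hneg : ∀ s', c.Frame s s' → I n s' → ¬ 0 < e.eval s') :
    Runs L (.loop e c) s (n * (T + 1) + 1) (I n) := by
  have key : ∀ j i s', i + j = n → c.Frame s s' → I i s' →
      Runs L (.loop e c) s' (j * (T + 1) + 1) (I n) := by
    intro j
    induction j with
    | zero =>
      rintro i s' rfl hF hI hs
      have := cost_le hL hs he
      exact ⟨s', _, .loop_neg (hneg s' hF hI), by unfold stepCost; omega, hs, hI⟩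
    | succ j ih =>
      intro i s' hij hF hI hs
      have := cost_le hL hs he
      obtain ⟨hp, hr⟩ := hpos i (by omega) s' hF hI
      obtain ⟨s₁, t₁, h₁, h₂, h₃, h₄⟩ := hr hs
      obtain ⟨s₂, t₂, h₅, h₆, h₇⟩ := ih (i + 1) s₁ (by omega) (hF.trans h₁.frame) h₄ h₃
      refine ⟨s₂, _, .loop_pos hp h₁ h₅, ?_, h₇⟩
      have e₁ : ((j + 1) * (T + 1) + 1) * stepCost L =
        T * stepCost L + (j * (T + 1) + 1) * stepCost L + stepCost L := by ring
      have e₂ : e.cost s' + 1 ≤ stepCost L := by unfold stepCost; omega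
      omega
  exact key n 0 s (by omega) (.refl _ _) h0

end Runs

/-- `for x = 0, …, y - 1 do c`. -/
def forLoop (x y : ℕ) (c : Prog) : Prog :=
  .seq (.assign x (.const 0))
    (.loop (.sub (.var y) (.var x)) (.seq c (.assign x (.add (.var x) (.const 1)))))

/-- The counter is incremented after the body has established `I (i + 1)`, so the invariant must be
insensitive to the counter (`hI`). The hypothesis `hnL` keeps the counter itself within the memory
bound. -/
theorem Runs.forLoop {L : ℕ} (hL : 1 ≤ L) {x y : ℕ} {c : Prog} {s : Store} {T n : ℕ}
    (I : ℕ → Store → Prop) (hn : s.var y = n) (hnL : (n : ℤ) ≤ 2 ^ L)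
    (hx : x ∉ c.modVars) (hy : y ∉ x :: c.modVars)
    (hI : ∀ i s' v, I i s' → I i (s'.setVar x v)) (h0 : I 0 s)
    (hc : ∀ i < n, ∀ s', (SparseMat.forLoop x y c).Frame s s' → s'.var x = i → I i s' →
      Runs L c s' T (I (i + 1))) :
    Runs L (SparseMat.forLoop x y c) s (n * (T + 2) + 2) (I n) := by
  have hyx : y ≠ x := fun h => hy (by simp [h])
  have hyc : y ∉ c.modVars := fun h => hy (by simp [h])
  have hT : n * (T + 2) + 2 = 1 + (n * (T + 1 + 1) + 1) := by ring
  rw [hT]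
  refine Runs.seq (Runs.assign hL (by simp [Exp.weight]) (by simp [Exp.eval]) ?_)
  refine (Runs.loop hL (fun i s' => s'.var x = i ∧ I i s') (by simp [Exp.weight, maxWeight])
    ⟨by simp [Exp.eval], hI _ _ _ h0⟩ ?_ ?_).mono le_rfl fun s' _ _ h => h.2
  · rintro i hi s' hF ⟨hxi, hIi⟩
    have hF' : (SparseMat.forLoop x y c).Frame s s' := by
      refine ⟨fun z hz => ?_, fun a ha => ?_⟩
      · have hz' : z ≠ x ∧ z ∉ c.modVars := by
          refine ⟨fun h => hz ?_, fun h => hz ?_⟩ <;> simp [SparseMat.forLoop, Prog.modVars, h]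
        rw [hF.1 z (by simpa [Prog.modVars, not_or] using hz'.symm)]
        simp [hz'.1]
      · rw [hF.2 a (by simpa [Prog.modArrs, SparseMat.forLoop] using ha)]
        rfl
    have hyn : s'.var y = n := by
      rw [hF'.1 y (by simp [SparseMat.forLoop, Prog.modVars, hyx, hyc]), hn]
    refine ⟨by simp only [Exp.eval, hyn, hxi]; omega, Runs.seq ?_⟩
    refine (hc i hi s' hF' hxi hIi).mono le_rfl fun s'' hF'' hb h => ?_
    have hxi' : s''.var x = i := by rw [hF''.1 x hx, hxi]
    refine Runs.assign hL (by simp [Exp.weight, maxWeight]) ?_ ⟨by simp [Exp.eval, hxi'], hI _ _ _ h⟩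
    simp only [Exp.eval, hxi']
    rw [abs_of_nonneg (by positivity)]
    omega
  · rintro s' hF ⟨hxi, -⟩
    have hyn : s'.var y = n := by
      rw [hF.1 y (by simp [Prog.modVars, hyx, hyc])]
      simp [hyx, hn]
    simp [Exp.eval, hyn, hxi]

/-! ### The program that computes a basis of the kernel

Variables: `1`, `2` the dimensions of the input matrix, `3` the offset of its entries in array `0`,
`4` the product of all denominators, `5`, `6`, `7` loop counters, `8` accumulator, `9` the pivot
plus one, `10` the determinant, `11` the dimension of the kernel, `12` the number of equations, `13`
the number of unknowns, `14`, `15` the strides of the matrix, `16`, `17` the dimensions of the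
output, `18` the square of variable `13`, `19` the number of entries. Arrays: `0` input and output,
`1` the adjugate matrix, `2` flags of pivots, `3` a row of products, `4` the list of free
columns. -/

open Exp Prog in
/-- Address of the numerator of an entry. -/
def entryAddr : Exp :=
  add (var 3) (mul (const 2) (add (mul (var 5) (var 14)) (mul (var 7) (var 15))))

open Exp in
/-- An entry, multiplied by the product of all denominators. -/
def scaledEntry : Exp :=
  div (mul (read 0 entryAddr) (var 4)) (read 0 (add entryAddr (const 1)))

open Exp Prog in
/-- Product of row `5` of the scaled matrix with row `6` of array `1`. -/
def dotProg : Prog :=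
  seq (assign 8 (const 0)) (forLoop 7 13
    (assign 8 (add (var 8) (mul scaledEntry (read 1 (add (mul (var 6) (var 13)) (var 7)))))))

open Exp Prog in
/-- All products of row `5` of the scaled matrix, and a free column with nonzero product. -/
def pivotProg : Prog :=
  seq (assign 9 (const 0)) (forLoop 6 13 (seq dotProg (seq (write 3 (var 6) (var 8))
    (ite (mul (sub (const 1) (read 2 (var 6))) (mul (var 8) (var 8)))
      (assign 9 (add (var 6) (const 1))) skip))))

open Exp Prog in
/-- Elimination with the pivot found by `pivotProg`. -/
def updateProg : Prog :=
  forLoop 6 18 (ite (mul (sub (div (var 6) (var 13)) (sub (var 9) (const 1)))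
      (sub (div (var 6) (var 13)) (sub (var 9) (const 1))))
    (write 1 (var 6) (div (sub (mul (read 3 (sub (var 9) (const 1))) (read 1 (var 6)))
      (mul (read 3 (div (var 6) (var 13)))
        (read 1 (add (mul (sub (var 9) (const 1)) (var 13))
          (sub (var 6) (mul (div (var 6) (var 13)) (var 13)))))))
      (var 10))) skip)

open Exp Prog in
/-- One equation is taken into account. -/
def stepProg : Prog :=
  seq pivotProg (ite (var 9) (seq updateProg (seq
    (assign 10 (read 3 (sub (var 9) (const 1)))) (write 2 (sub (var 9) (const 1)) (const 1)))) skip)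

/-- A memory in which array `0`, the dimensions `p`, `q` and the strides represent the equations
`w`. -/
structure Represents (s : Store) (p q : ℕ) (w : ℕ → ℕ → ℤ) : Prop where
  rows : s.var 12 = p
  cols : s.var 13 = q
  sq : s.var 18 = (q * q : ℕ)
  entry : ∀ i < p, ∀ j < q, (s.arr 0 (s.var 3 + 2 * (i * s.var 14 + j * s.var 15)) * s.var 4) /
    s.arr 0 (s.var 3 + 2 * (i * s.var 14 + j * s.var 15) + 1) = w i j

theorem Represents.of_agree {s s' : Store} {p q : ℕ} {w : ℕ → ℕ → ℤ} (h : Represents s p q w)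
    (h₃ : s'.var 3 = s.var 3) (h₄ : s'.var 4 = s.var 4) (h₁₂ : s'.var 12 = s.var 12)
    (h₁₃ : s'.var 13 = s.var 13) (h₁₄ : s'.var 14 = s.var 14) (h₁₅ : s'.var 15 = s.var 15)
    (h₁₈ : s'.var 18 = s.var 18) (h₀ : s'.arr 0 = s.arr 0) : Represents s' p q w := by
  constructor
  · rw [h₁₂, h.rows]
  · rw [h₁₃, h.cols]
  · rw [h₁₈, h.sq]
  · rw [h₃, h₄, h₁₄, h₁₅, h₀]; exact h.entry

theorem Represents.frame {s s' : Store} {p q : ℕ} {w : ℕ → ℕ → ℤ} {c : Prog}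
    (h : Represents s p q w) (hF : c.Frame s s')
    (hv : (∀ x ∈ [3, 4, 12, 13, 14, 15, 18], x ∉ c.modVars) ∧ 0 ∉ c.modArrs := by decide) :
    Represents s' p q w := by
  obtain ⟨hv, ha⟩ := hv
  refine h.of_agree ?_ ?_ ?_ ?_ ?_ ?_ ?_ (hF.2 0 ha) <;> exact hF.1 _ (hv _ (by simp))

/-! ### Inner loops of the elimination -/

section

variable {L : ℕ} {s : Store} {p q : ℕ} {w : ℕ → ℕ → ℤ}

theorem Represents.cols_le (h : Represents s p q w) (hb : s.Bounded L) : (q : ℤ) ≤ 2 ^ L := by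
  have := hb.1 13
  rw [h.cols] at this
  exact (le_abs_self _).trans this

/-- Every partial sum is a value of the accumulator, so a bound on the total alone would not do. -/
theorem runs_dotProg (hL : 1 ≤ L) (h : Represents s p q w) {i k : ℕ} (hi : i < p)
    (h5 : s.var 5 = i) (h6 : s.var 6 = k)
    (hbd : ∀ j ≤ q, |∑ x ∈ Finset.range j, w i x * s.arr 1 ((k * q + x : ℕ) : ℤ)| ≤ 2 ^ L) :
    Runs L dotProg s (q * 3 + 3)
      fun s' => s'.var 8 = ∑ x ∈ Finset.range q, w i x * s.arr 1 ((k * q + x : ℕ) : ℤ) := by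
  intro hs
  have hq := h.cols_le hs
  revert hs
  have hT : q * 3 + 3 = 1 + (q * (1 + 2) + 2) := by ring
  rw [hT]
  refine Runs.seq (Runs.assign hL (by decide) (by simp [Exp.eval]) ?_)
  refine Runs.forLoop hL (fun j s' => s'.var 8 =
    ∑ x ∈ Finset.range j, w i x * s.arr 1 ((k * q + x : ℕ) : ℤ)) (by simp [h.cols]) hq
    (by decide) (by decide) (by simp) (by simp [Exp.eval]) ?_
  intro j hj s' hF h7 hI
  have h' : Represents s' p q w := by
    refine Represents.frame (s := s.setVar 8 0) ?_ hF
    exact h.of_agree rfl rfl rfl rfl rfl rfl rfl rfl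
  have h5' : s'.var 5 = i := by rw [hF.1 5 (by decide)]; simpa using h5
  have h6' : s'.var 6 = k := by rw [hF.1 6 (by decide)]; simpa using h6
  have h1' : s'.arr 1 = s.arr 1 := hF.2 1 (by decide)
  have hev : Exp.eval s' (.add (.var 8) (.mul scaledEntry
      (.read 1 (.add (.mul (.var 6) (.var 13)) (.var 7))))) =
      ∑ x ∈ Finset.range (j + 1), w i x * s.arr 1 ((k * q + x : ℕ) : ℤ) := by
    simp only [Exp.eval, scaledEntry, entryAddr, h5', h6', h7, h'.cols, h'.entry i hi j hj, h1',
      hI, Finset.sum_range_succ]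
    push_cast
    rfl
  refine Runs.assign hL (by decide) ?_ ?_
  · rw [hev]; exact hbd _ hj
  · simp only [Store.var_setVar, if_true, hev]

/-- Variable `9` holds the pivot plus one, which leaves `0` to signal that every free column already
solves the equation. Any free column with nonzero product is good enough; the last one found wins.
-/
theorem runs_pivotProg (hL : 1 ≤ L) (h : Represents s p q w) {i : ℕ} (hi : i < p)
    (h5 : s.var 5 = i)
    (hbd : ∀ k < q, ∀ j ≤ q,
      |∑ x ∈ Finset.range j, w i x * s.arr 1 ((k * q + x : ℕ) : ℤ)| ≤ 2 ^ L)
    (hfl : ∀ k < q, s.arr 2 (k : ℕ) = 0 ∨ s.arr 2 (k : ℕ) = 1) :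
    Runs L pivotProg s (q * (q * 3 + 8) + 3) fun s' =>
      (∀ k < q, s'.arr 3 (k : ℕ) =
        ∑ x ∈ Finset.range q, w i x * s.arr 1 ((k * q + x : ℕ) : ℤ)) ∧
      ((s'.var 9 = 0 ∧ ∀ k < q, s.arr 2 (k : ℕ) = 0 →
        ∑ x ∈ Finset.range q, w i x * s.arr 1 ((k * q + x : ℕ) : ℤ) = 0) ∨
      ∃ k < q, s'.var 9 = k + 1 ∧ s.arr 2 (k : ℕ) = 0 ∧
        ∑ x ∈ Finset.range q, w i x * s.arr 1 ((k * q + x : ℕ) : ℤ) ≠ 0) := by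
  intro hs
  have hq := h.cols_le hs
  revert hs
  set v : ℕ → ℤ := fun k => ∑ x ∈ Finset.range q, w i x * s.arr 1 ((k * q + x : ℕ) : ℤ) with hv
  have hT : q * (q * 3 + 8) + 3 = 1 + (q * ((q * 3 + 3) + (1 + (1 + 1)) + 2) + 2) := by ring
  rw [hT]
  refine Runs.seq (Runs.assign hL (by decide) (by simp [Exp.eval]) ?_)
  refine Runs.forLoop hL (T := (q * 3 + 3) + (1 + (1 + 1)))
    (fun n s' => (∀ k < n, s'.arr 3 (k : ℕ) = v k) ∧
      ((s'.var 9 = 0 ∧ ∀ k < n, s.arr 2 (k : ℕ) = 0 → v k = 0) ∨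
      ∃ k < q, s'.var 9 = k + 1 ∧ s.arr 2 (k : ℕ) = 0 ∧ v k ≠ 0)) (by simp [h.cols]) hq
    (by decide) (by decide) (by simp) (by simp [Exp.eval]) ?_
  rintro k hk s' hF h6 ⟨hI₁, hI₂⟩
  have h' : Represents s' p q w := by
    refine Represents.frame (s := s.setVar 9 0) ?_ hF
    exact h.of_agree rfl rfl rfl rfl rfl rfl rfl rfl
  have h5' : s'.var 5 = i := by rw [hF.1 5 (by decide)]; simpa using h5
  have h1' : s'.arr 1 = s.arr 1 := hF.2 1 (by decide)
  have h2' : s'.arr 2 = s.arr 2 := hF.2 2 (by decide)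
  refine Runs.seq ((runs_dotProg hL h' hi h5' h6 (by rw [h1']; exact hbd k hk)).mono le_rfl
    fun s'' hF'' hb'' h8 => ?_)
  have h6'' : s''.var 6 = k := by rw [hF''.1 6 (by decide), h6]
  have h9'' : s''.var 9 = s'.var 9 := hF''.1 9 (by decide)
  have h2'' : s''.arr 2 = s.arr 2 := by rw [hF''.2 2 (by decide), h2']
  have h3'' : s''.arr 3 = s'.arr 3 := hF''.2 3 (by decide)
  have h8'' : s''.var 8 = v k := by rw [h8, h1']
  refine Runs.seq (Runs.write hL (by decide) (by decide) (by simpa [Exp.eval] using hb''.1 8) ?_)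
  have hrow : ∀ j < k + 1,
      (s''.setArr 3 (Exp.eval s'' (.var 6)) (Exp.eval s'' (.var 8))).arr 3 (j : ℕ) = v j := by
    intro j hj
    simp only [Exp.eval, Store.arr_setArr, h6'', h8'', h3'', true_and, Nat.cast_inj]
    split_ifs with hjk
    · rw [hjk]
    · exact hI₁ j (by omega)
  -- The guard is `(1 - flag) * v k ^ 2`; as the flag is `0` or `1`, it is positive exactly if `k`
  -- is free and `v k ≠ 0`.
  refine Runs.ite hL (by decide) (fun hc => ?_) (fun hc => ?_)
  · simp only [Exp.eval, Store.arr_setArr, Store.var_setArr, h6'', h8'', h2''] at hc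
    norm_num at hc
    have hfree : s.arr 2 (k : ℕ) = 0 := by
      rcases hfl k hk with h0 | h0
      · exact h0
      · rw [h0] at hc; norm_num at hc
    have hne : v k ≠ 0 := by
      intro h0; rw [h0] at hc; norm_num at hc
    refine Runs.assign hL (by decide) ?_ ⟨?_, Or.inr ⟨k, hk, ?_, hfree, hne⟩⟩
    · simp only [Exp.eval, Store.var_setArr, h6'']
      rw [abs_of_nonneg (by positivity)]
      omega
    · simpa using hrow
    · simp [Exp.eval, h6'']
  · simp only [Exp.eval, Store.arr_setArr, Store.var_setArr, h6'', h8'', h2''] at hc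
    norm_num at hc
    refine Runs.skip ⟨hrow, ?_⟩
    rcases hI₂ with ⟨h9, hI₂⟩ | hI₂
    · refine Or.inl ⟨by simp [h9'', h9], fun j hj hfree => ?_⟩
      rcases Nat.lt_succ_iff_lt_or_eq.1 hj with hj | rfl
      · exact hI₂ j hj hfree
      · rw [hfree] at hc
        nlinarith
    · refine Or.inr ?_
      simpa [h9''] using hI₂

/-- One loop over the flat index `z`, with row `z / q` and column `z % q`, updates the array in
place. This is safe: the pivot row never changes, and a cell outside it is read only when it is
itself rewritten. -/
theorem runs_updateProg (hL : 1 ≤ L) (h : Represents s p q w) {k : ℕ} (hk : k < q)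
    (h9 : s.var 9 = k + 1) (N : ℕ → ℕ → ℤ) (hN : ∀ a < q, a ≠ k → ∀ x < q,
      (s.arr 3 k * s.arr 1 ((a * q + x : ℕ) : ℤ) - s.arr 3 a * s.arr 1 ((k * q + x : ℕ) : ℤ)) /
        s.var 10 = N a x)
    (hNk : ∀ x < q, s.arr 1 ((k * q + x : ℕ) : ℤ) = N k x)
    (hbd : ∀ a < q, ∀ x < q, |N a x| ≤ 2 ^ L) :
    Runs L updateProg s (q * q * 4 + 2) fun s' =>
      ∀ a < q, ∀ x < q, s'.arr 1 ((a * q + x : ℕ) : ℤ) = N a x := by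
  intro hs
  have hq2 : ((q * q : ℕ) : ℤ) ≤ 2 ^ L := by
    have := hs.1 18
    rw [h.sq] at this
    exact (le_abs_self _).trans this
  have hq0 : 0 < q := by omega
  revert hs
  have hdiv : ∀ {a x : ℕ}, x < q → (a * q + x) / q = a := fun hx => by
    rw [mul_comm, Nat.mul_add_div hq0, Nat.div_eq_of_lt hx, add_zero]
  have hmod : ∀ {a x : ℕ}, x < q → (a * q + x) % q = x := fun hx => by
    rw [mul_comm, Nat.mul_add_mod, Nat.mod_eq_of_lt hx]
  have hT : q * q * 4 + 2 = q * q * (1 + 1 + 2) + 2 := by ring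
  rw [hT]
  refine Runs.mono (Runs.forLoop hL (fun n s' => ∀ z < q * q, s'.arr 1 (z : ℕ) =
      if z < n then N (z / q) (z % q) else s.arr 1 (z : ℕ)) h.sq hq2 (by decide) (by decide)
      (by simp) (by simp) ?_) le_rfl ?_
  · rintro z hz s' hF h6 hI
    have h13' : s'.var 13 = q := by rw [hF.1 13 (by decide), h.cols]
    have h9' : s'.var 9 = k + 1 := by rw [hF.1 9 (by decide), h9]
    have h10' : s'.var 10 = s.var 10 := hF.1 10 (by decide)
    have h3' : s'.arr 3 = s.arr 3 := hF.2 3 (by decide)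
    have hzq : z / q < q := Nat.div_lt_of_lt_mul hz
    have hzm : z % q < q := Nat.mod_lt _ hq0
    have hzz : z / q * q + z % q = z := by rw [mul_comm]; exact Nat.div_add_mod z q
    have hdz : (z : ℤ) / (q : ℤ) = ((z / q : ℕ) : ℤ) := by norm_cast
    have hmz : (z : ℤ) - ((z / q : ℕ) : ℤ) * q = ((z % q : ℕ) : ℤ) := by
      rw [sub_eq_iff_eq_add, add_comm]; exact_mod_cast hzz.symm
    have hkk : ((k : ℤ) + 1 - 1) = (k : ℕ) := by ring
    -- The guard is the square of `z / q - k`, a test for being off the pivot row.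
    refine Runs.ite hL (by decide) (fun hc => ?_) (fun hc => ?_)
    · simp only [Exp.eval, h6, h13', h9', hdz, hkk] at hc
      have hne : z / q ≠ k := by
        intro h0; rw [h0] at hc; norm_num at hc
      have hrowk : s'.arr 1 ((k * q + z % q : ℕ) : ℤ) = s.arr 1 ((k * q + z % q : ℕ) : ℤ) := by
        rw [hI _ (by nlinarith)]
        split_ifs
        · rw [hdiv hzm, hmod hzm, hNk _ hzm]
        · rfl
      have hrowz : s'.arr 1 (z : ℕ) = s.arr 1 ((z / q * q + z % q : ℕ) : ℤ) := by
        rw [hI _ hz, if_neg (lt_irrefl _), hzz]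
      have hev := hN _ hzq hne _ hzm
      have hcast : (k : ℤ) * q + ((z % q : ℕ) : ℤ) = ((k * q + z % q : ℕ) : ℤ) := by push_cast; rfl
      refine Runs.write hL (by decide) (by decide) ?_ ?_
      · simp only [Exp.eval, h6, h13', h9', hdz, hkk, hmz, hcast, h3', h10', hrowk, hrowz, hev]
        exact hbd _ hzq _ hzm
      · intro y hy
        simp only [Exp.eval, h6, h13', h9', hdz, hkk, hmz, hcast, h3', h10', hrowk, hrowz, hev,
          Store.arr_setArr, true_and, Nat.cast_inj]
        by_cases hyz : y = z
        · subst hyz; simp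
        · rw [if_neg hyz, hI y hy]
          congr 1
          simp only [eq_iff_iff]; omega
    · simp only [Exp.eval, h6, h13', h9', hdz, hkk] at hc
      have heq : z / q = k := by
        by_contra h0
        have : ((z / q : ℕ) : ℤ) - (k : ℤ) ≠ 0 := by
          rw [sub_ne_zero]; exact_mod_cast h0
        exact hc (mul_self_pos.2 this)
      refine Runs.skip fun y hy => ?_
      rw [hI y hy]
      by_cases hyz : y = z
      · subst hyz
        have := hNk _ hzm
        rw [← heq, hzz] at this
        simp [this]
      · congr 1
        simp only [eq_iff_iff]; omega
  · intro s' _ _ hQ a ha x hx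
    have := hQ (a * q + x) (by nlinarith)
    rwa [if_pos (by nlinarith), hdiv hx, hmod hx] at this

end

/-! ### Replacing a row, and the adjugate -/

section Adjugate

variable {q : ℕ} (M : Matrix (Fin q) (Fin q) ℤ)

/-- Laplace expansion along the replaced row, whose cofactors do not depend on that row. -/
theorem det_updateRow_eq_sum (r : Fin q → ℤ) (p : Fin q) :
    (M.updateRow p r).det = ∑ x, r x * M.adjugate x p := by
  rw [← Matrix.cramer_transpose_apply, Matrix.cramer_eq_adjugate_mulVec,
    ← Matrix.adjugate_transpose]
  simp [Matrix.mulVec, dotProduct, mul_comm]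

theorem adjugate_updateRow_self (r : Fin q → ℤ) (p x : Fin q) :
    (M.updateRow p r).adjugate x p = M.adjugate x p := by
  simp [Matrix.adjugate_apply]

/-- Write `u` for the right-hand side as a vector in `x`. The new row `r` kills `u` by antisymmetry,
and the old rows are evaluated by `M * adj M = det M • 1`, so `M' u` is `det M * v p` times the
`k`-th unit vector. Applying `adj M'` and `det M' = v p` gives the claim multiplied by `v p`, which
cancels. -/
theorem det_mul_adjugate_updateRow (r : Fin q → ℤ) {p : Fin q}
    (hp : ∑ x, r x * M.adjugate x p ≠ 0) {k : Fin q} (hk : k ≠ p) (x : Fin q) :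
    M.det * (M.updateRow p r).adjugate x k =
      (∑ y, r y * M.adjugate y p) * M.adjugate x k -
        (∑ y, r y * M.adjugate y k) * M.adjugate x p := by
  set M' := M.updateRow p r with hM'
  set v : Fin q → ℤ := fun k => ∑ y, r y * M.adjugate y k with hv
  have hdet : M'.det = v p := det_updateRow_eq_sum M r p
  set u : Fin q → ℤ := fun x => v p * M.adjugate x k - v k * M.adjugate x p with hu
  have hrow : ∀ i j, ∑ y, M i y * M.adjugate y j = if i = j then M.det else 0 := by
    intro i j
    have := congrFun (congrFun M.mul_adjugate i) j
    simpa [Matrix.mul_apply, Matrix.one_apply] using this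
  have hmul : M'.mulVec u = Pi.single k (M.det * v p) := by
    funext i
    have hsum : ∀ c : Fin q → ℤ, ∑ y, c y * u y =
        v p * ∑ y, c y * M.adjugate y k - v k * ∑ y, c y * M.adjugate y p := by
      intro c
      simp only [hu, Finset.mul_sum, ← Finset.sum_sub_distrib]
      exact Finset.sum_congr rfl fun _ _ => by ring
    by_cases hi : i = p
    · subst hi
      simp only [Matrix.mulVec, dotProduct, hM', Matrix.updateRow_self]
      rw [hsum r, Pi.single_eq_of_ne hk.symm]
      change v i * v k - v k * v i = 0
      ring
    · simp only [Matrix.mulVec, dotProduct, hM', Matrix.updateRow_ne hi]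
      rw [hsum (M i), hrow, hrow, if_neg hi]
      by_cases hik : i = k
      · subst hik; simp [mul_comm]
      · rw [if_neg hik, Pi.single_eq_of_ne hik]; ring
  have h₂ := congrArg (fun z => M'.adjugate.mulVec z x) hmul
  simp only [Matrix.mulVec_mulVec, Matrix.adjugate_mul, Matrix.smul_mulVec, Matrix.one_mulVec,
    Matrix.mulVec_single, Pi.smul_apply, smul_eq_mul, hdet] at h₂
  have h₃ : v p * u x = v p * (M.det * M'.adjugate x k) := by
    rw [h₂]; simp [Matrix.col]; ring
  exact (mul_left_cancel₀ hp h₃).symm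

/-- The entry is the determinant of `M` with one row replaced by a unit vector, which respects the
bound since `1 ≤ B`; the Leibniz formula has `q!` terms. -/
theorem abs_adjugate_le {B : ℤ} (hB : 1 ≤ B) (hM : ∀ i j, |M i j| ≤ B) (x k : Fin q) :
    |M.adjugate x k| ≤ q.factorial * B ^ q := by
  rw [Matrix.adjugate_apply]
  have := Matrix.det_le (A := M.updateRow k (Pi.single x 1))
    (abv := AbsoluteValue.abs) (x := B) (fun i j => by
      change |_| ≤ B
      rw [Matrix.updateRow_apply]
      split_ifs
      · rw [Pi.single_apply]; split_ifs <;> simp <;> omega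
      · exact hM i j)
  simpa using this

end Adjugate

/-! ### Bases of kernels -/

/-- The rows of `V` are the columns of an adjugate matrix that form a basis of the space orthogonal
to the rows of `w`: the other columns correspond to rows of `w`. -/
def IsKernelBasis {p q f : ℕ} (w : Fin p → Fin q → ℤ) (V : Fin f → Fin q → ℤ) : Prop :=
  ∃ (M : Matrix (Fin q) (Fin q) ℤ) (e : Fin f → Fin q), M.det ≠ 0 ∧ Function.Injective e ∧
    (∀ y x, V y x = M.adjugate x (e y)) ∧ (∀ k, k ∈ Set.range e ∨ ∃ i, M k = w i) ∧
    ∀ i y, ∑ x, w i x * V y x = 0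

theorem sum_mul_eq_zero_of_scaled {q : ℕ} {a b : Fin q → ℚ} {w v : Fin q → ℤ} {D : ℚ}
    (hD : D ≠ 0) (ha : ∀ x, a x * D = w x) (hb : ∀ x, b x = v x) (h : ∑ x, w x * v x = 0) :
    ∑ x, a x * b x = 0 := by
  have : D * ∑ x, a x * b x = 0 := by
    rw [Finset.mul_sum]
    calc ∑ x, D * (a x * b x) = ((∑ x, w x * v x : ℤ) : ℚ) := by
          push_cast
          exact Finset.sum_congr rfl fun x _ => by rw [← ha, hb]; ring
      _ = 0 := by rw [h]; simp
  exact (mul_eq_zero.1 this).resolve_left hD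

/-- The vectors are distinct columns of the invertible matrix `adj M`, hence independent. For `b` in
the kernel, `det M • b = ∑ (M b)_k • (adj M)_k`, and `(M b)_k = 0` whenever row `k` of `M` is an
equation, so only free columns remain. -/
theorem IsKernelBasis.isFullNullMatrix {p q f : ℕ} {w : Fin p → Fin q → ℤ}
    {V : Fin f → Fin q → ℤ} (h : IsKernelBasis w V) {A : Matrix (Fin p) (Fin q) ℚ} {D : ℚ}
    (hD : D ≠ 0) (hA : ∀ i x, A i x * D = w i x) :
    IsFullNullMatrix A (Matrix.of fun x y => (V y x : ℚ)) := by
  obtain ⟨M, e, hM, he, hV, hk, hw⟩ := h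
  set Mq : Matrix (Fin q) (Fin q) ℚ := (Int.castRingHom ℚ).mapMatrix M with hMq
  have hadj : ∀ i j, Mq.adjugate i j = (M.adjugate i j : ℚ) := fun i j => by
    rw [hMq, ← RingHom.map_adjugate]; simp
  have hdet : Mq.det ≠ 0 := by
    rw [hMq, ← RingHom.map_det]; simpa using hM
  have hunit : IsUnit Mq.adjugate := by
    rw [Matrix.isUnit_iff_isUnit_det, Matrix.det_adjugate]
    exact (pow_ne_zero _ hdet).isUnit
  have hcol : (Matrix.of fun x y => (V y x : ℚ)).col = Mq.adjugate.col ∘ e := by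
    funext y x
    simp [hV, hadj]
  refine ⟨?_, le_antisymm ?_ ?_⟩
  · rw [hcol]
    exact (Matrix.linearIndependent_cols_iff_isUnit.2 hunit).comp e he
  · rw [Submodule.span_le]
    rintro _ ⟨y, rfl⟩
    rw [SetLike.mem_coe, LinearMap.mem_ker]
    funext i
    exact sum_mul_eq_zero_of_scaled hD (hA i) (fun x => by simp [Matrix.col]) (hw i y)
  · intro b hb
    rw [LinearMap.mem_ker, Matrix.mulVecLin_apply] at hb
    have hdb : Mq.det • b = ∑ k, (Mq.mulVec b) k • Mq.adjugate.col k := by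
      have : Mq.adjugate.mulVec (Mq.mulVec b) = Mq.det • b := by
        rw [Matrix.mulVec_mulVec, Matrix.adjugate_mul, Matrix.smul_mulVec, Matrix.one_mulVec]
      rw [← this, Matrix.mulVec_eq_sum]
      simp only [op_smul_eq_smul]
      rfl
    rw [← Submodule.smul_mem_iff _ hdet, hdb]
    refine Submodule.sum_mem _ fun k _ => ?_
    rcases hk k with ⟨y, rfl⟩ | ⟨i, hi⟩
    · refine Submodule.smul_mem _ _ (Submodule.subset_span ⟨y, ?_⟩)
      rw [hcol]; rfl
    · have h0 : Mq.mulVec b k = 0 := by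
        have h1 : Mq.mulVec b k = D * A.mulVec b i := by
          simp only [Matrix.mulVec, dotProduct, Finset.mul_sum]
          refine Finset.sum_congr rfl fun x _ => ?_
          have : Mq k x = A i x * D := by rw [hA, ← hi]; simp [hMq]
          rw [this]; ring
        rw [h1, hb]; simp
      rw [h0, zero_smul]
      exact Submodule.zero_mem _

/-- The dual argument, without a dimension count: `det M • b = ∑ (b * adj M)_k • M_k`. If `b` is
orthogonal to all vectors `V y`, the coefficients at free `k` vanish, and the remaining rows `M_k`
are multiples of columns of `A`. -/
theorem IsKernelBasis.isFullNullMatrix_transpose {p q f : ℕ} {w : Fin p → Fin q → ℤ}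
    {V : Fin f → Fin q → ℤ} (h : IsKernelBasis w V) {A : Matrix (Fin q) (Fin p) ℚ} {D : ℚ}
    (hD : D ≠ 0) (hA : ∀ i x, A x i * D = w i x) (hli : LinearIndependent ℚ A.col) :
    IsFullNullMatrix (Matrix.of fun y x => (V y x : ℚ)) A := by
  obtain ⟨M, e, hM, he, hV, hk, hw⟩ := h
  set Mq : Matrix (Fin q) (Fin q) ℚ := (Int.castRingHom ℚ).mapMatrix M with hMq
  have hadj : ∀ i j, Mq.adjugate i j = (M.adjugate i j : ℚ) := fun i j => by
    rw [hMq, ← RingHom.map_adjugate]; simp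
  have hdet : Mq.det ≠ 0 := by
    rw [hMq, ← RingHom.map_det]; simpa using hM
  refine ⟨hli, le_antisymm ?_ ?_⟩
  · rw [Submodule.span_le]
    rintro _ ⟨i, rfl⟩
    rw [SetLike.mem_coe, LinearMap.mem_ker]
    funext y
    have := sum_mul_eq_zero_of_scaled hD (a := fun x => A x i) (b := fun x => (V y x : ℚ)) (hA i)
      (fun x => rfl) (hw i y)
    simpa [Matrix.mulVec, dotProduct, Matrix.col, mul_comm] using this
  · intro b hb
    rw [LinearMap.mem_ker, Matrix.mulVecLin_apply] at hb
    have hdb : Mq.det • b = ∑ k, (Matrix.vecMul b Mq.adjugate) k • Mq k := by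
      have : Matrix.vecMul (Matrix.vecMul b Mq.adjugate) Mq = Mq.det • b := by
        rw [Matrix.vecMul_vecMul, Matrix.adjugate_mul, Matrix.vecMul_smul, Matrix.vecMul_one]
      rw [← this, Matrix.vecMul_eq_sum]
    rw [← Submodule.smul_mem_iff _ hdet, hdb]
    refine Submodule.sum_mem _ fun k _ => ?_
    rcases hk k with ⟨y, rfl⟩ | ⟨i, hi⟩
    · have h0 : Matrix.vecMul b Mq.adjugate (e y) = 0 := by
        have := congrFun hb y
        simp only [Matrix.mulVec, dotProduct, Matrix.of_apply, hV, Pi.zero_apply] at this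
        simpa [Matrix.vecMul, dotProduct, hadj, mul_comm] using this
      rw [h0, zero_smul]
      exact Submodule.zero_mem _
    · have : Mq k = D • A.col i := by
        funext x
        simp only [Pi.smul_apply, Matrix.col_apply, smul_eq_mul]
        rw [mul_comm, hA, ← hi]; simp [hMq]
      rw [this]
      exact Submodule.smul_mem _ _ (Submodule.smul_mem _ _ (Submodule.subset_span ⟨i, rfl⟩))

/-! ### Full null matrices of one matrix differ by an invertible factor -/

theorem IsFullNullMatrix.mul_isUnit {m n k : ℕ} {A : Matrix (Fin m) (Fin n) ℚ}
    {N : Matrix (Fin n) (Fin k) ℚ} (h : IsFullNullMatrix A N) {X : Matrix (Fin k) (Fin k) ℚ}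
    (hX : IsUnit X) : IsFullNullMatrix A (N * X) := by
  obtain ⟨h₁, h₂⟩ := h
  rw [← Matrix.mulVec_injective_iff] at h₁
  rw [← Matrix.range_mulVecLin] at h₂
  refine ⟨?_, ?_⟩
  · rw [← Matrix.mulVec_injective_iff]
    intro u v huv
    simp only [← Matrix.mulVec_mulVec] at huv
    exact Matrix.mulVec_injective_of_isUnit hX (h₁ huv)
  · rw [← Matrix.range_mulVecLin, Matrix.mulVecLin_mul, LinearMap.range_comp_of_range_eq_top, h₂]
    rw [LinearMap.range_eq_top]
    exact Matrix.mulVec_surjective_iff_isUnit.2 hX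

/-- Both column counts equal the dimension of the null space, so `X` is square. It is injective,
hence invertible, because `N * X = N'` has independent columns. The conclusion is an equality in
`RatMatrix` to absorb `k' = k`. -/
theorem IsFullNullMatrix.exists_eq_mul {m n k k' : ℕ} {A : Matrix (Fin m) (Fin n) ℚ}
    {N : Matrix (Fin n) (Fin k) ℚ} {N' : Matrix (Fin n) (Fin k') ℚ} (h : IsFullNullMatrix A N)
    (h' : IsFullNullMatrix A N') : ∃ X : Matrix (Fin k) (Fin k) ℚ, IsUnit X ∧
      (⟨n, k', N'⟩ : RatMatrix) = ⟨n, k, N * X⟩ := by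
  have hk : k' = k := by
    have h₁ := finrank_span_eq_card h.1
    have h₂ := finrank_span_eq_card h'.1
    rw [h.2] at h₁
    rw [h'.2, h₁] at h₂
    simpa using h₂.symm
  subst hk
  have hex : ∀ j, ∃ x : Fin k' → ℚ, N.mulVec x = N'.col j := by
    intro j
    have : N'.col j ∈ LinearMap.range N.mulVecLin := by
      rw [Matrix.range_mulVecLin, h.2, ← h'.2]
      exact Submodule.subset_span ⟨j, rfl⟩
    exact this
  choose x hx using hex
  have hN : N' = N * Matrix.of (fun i j => x j i) := by
    ext i j
    exact (congrFun (hx j) i).symm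
  refine ⟨Matrix.of (fun i j => x j i), ?_, by rw [← hN]⟩
  rw [← Matrix.mulVec_injective_iff_isUnit]
  have h₁ := Matrix.mulVec_injective_iff.2 h'.1
  intro u v huv
  apply h₁
  rw [hN, ← Matrix.mulVec_mulVec, ← Matrix.mulVec_mulVec, huv]

/-! ### Correctness of the elimination -/

/-- The state after `i` equations: array `1` is the adjugate of a matrix `M` whose pivot rows are
equations, and the free columns of the adjugate solve the first `i` equations. -/
def ElimInv (p q : ℕ) (w : ℕ → ℕ → ℤ) (B : ℤ) (i : ℕ) (s : Store) : Prop :=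
  ∃ M : Matrix (Fin q) (Fin q) ℤ, (∀ a b, |M a b| ≤ B) ∧ M.det = s.var 10 ∧ M.det ≠ 0 ∧
    (∀ k x : Fin q, s.arr 1 ((k * q + x : ℕ) : ℤ) = M.adjugate x k) ∧
    ∀ k : Fin q, (s.arr 2 (k : ℕ) = 0 ∧ ∀ i' < i, ∑ x : Fin q, w i' x * M.adjugate x k = 0) ∨
      (s.arr 2 (k : ℕ) = 1 ∧ ∃ i' < p, ∀ x, M k x = w i' x)

section

variable {L : ℕ} {s : Store} {p q : ℕ} {w : ℕ → ℕ → ℤ} {B : ℤ}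

theorem ElimInv.of_agree {s' : Store} {i : ℕ} (h : ElimInv p q w B i s)
    (h₁₀ : s'.var 10 = s.var 10) (h₁ : s'.arr 1 = s.arr 1) (h₂ : s'.arr 2 = s.arr 2) :
    ElimInv p q w B i s' := by
  unfold ElimInv
  rw [h₁₀, h₁, h₂]
  exact h

/-- With a pivot `k`, row `k` of `M` becomes the equation and the products computed by `pivotProg`
give the new determinant and adjugate. Without one, nothing needs to change. -/
theorem runs_stepProg (hL : 1 ≤ L) (h : Represents s p q w) {i : ℕ} (hi : i < p)
    (h5 : s.var 5 = i) (hB : 1 ≤ B) (hw : ∀ i < p, ∀ x < q, |w i x| ≤ B)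
    (hbd : (q + 1) * (B * (q.factorial * B ^ q)) ≤ 2 ^ L) (hI : ElimInv p q w B i s) :
    Runs L stepProg s (q * (q * 3 + 8) + 3 + (1 + (q * q * 4 + 2 + (1 + 1))))
      (ElimInv p q w B (i + 1)) := by
  obtain ⟨M, hMB, hMd, hM0, hadj, hfl⟩ := hI
  have hA : ∀ x k, |M.adjugate x k| ≤ q.factorial * B ^ q := abs_adjugate_le M hB hMB
  have hsum : ∀ k : Fin q, ∑ x ∈ Finset.range q, w i x * s.arr 1 ((k * q + x : ℕ) : ℤ) =
      ∑ x : Fin q, w i x * M.adjugate x k := by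
    intro k
    rw [Finset.sum_range]
    exact Finset.sum_congr rfl fun x _ => by rw [hadj]
  have hB0 : 0 ≤ B * (q.factorial * B ^ q) := by positivity
  -- The factor `q + 1` in `hbd`, rather than `q`, makes this true for `q = 0` too.
  have hAL : q.factorial * B ^ q ≤ 2 ^ L := by
    refine le_trans ?_ hbd
    have h₁ : 0 ≤ q.factorial * B ^ q := by positivity
    nlinarith
  refine Runs.seq (Runs.mono (runs_pivotProg hL h hi h5 ?_ ?_) le_rfl ?_)
  · intro k hk j hj
    refine (Finset.abs_sum_le_sum_abs _ _).trans ?_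
    calc _ ≤ ∑ x ∈ Finset.range j, B * (q.factorial * B ^ q) := by
          refine Finset.sum_le_sum fun x hx => ?_
          have hxq : x < q := by have := Finset.mem_range.1 hx; omega
          rw [abs_mul, hadj ⟨k, hk⟩ ⟨x, hxq⟩]
          exact mul_le_mul (hw i hi x hxq) (hA _ _) (abs_nonneg _) (by omega)
      _ = j * (B * (q.factorial * B ^ q)) := by simp
      _ ≤ (q + 1) * (B * (q.factorial * B ^ q)) := by gcongr; omega
      _ ≤ _ := hbd
  · intro k hk
    rcases hfl ⟨k, hk⟩ with h' | h'
    exacts [Or.inl h'.1, Or.inr h'.1]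
  · rintro s₁ hF hb₁ ⟨hv, hpiv⟩
    have h1 : s₁.arr 1 = s.arr 1 := hF.2 1 (by decide)
    have h2 : s₁.arr 2 = s.arr 2 := hF.2 2 (by decide)
    have h10 : s₁.var 10 = s.var 10 := hF.1 10 (by decide)
    refine Runs.ite hL (by decide) (fun hc => ?_) (fun hc => ?_)
    · rcases hpiv with ⟨h9, -⟩ | ⟨k, hk, h9, hk2, hvk⟩
      · simp [Exp.eval, h9] at hc
      set k' : Fin q := ⟨k, hk⟩
      set r : Fin q → ℤ := fun x => w i x with hr
      rw [hsum k'] at hvk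
      have hrep : Represents s₁ p q w := h.frame hF
      have hvF : ∀ a : Fin q, s₁.arr 3 (a : ℕ) = ∑ x, r x * M.adjugate x a := fun a => by
        rw [hv a a.2, hsum a]
      -- The new contents are the adjugate after the row replacement; the default `0` lies outside
      -- the range that is used.
      refine Runs.seq (Runs.mono (runs_updateProg hL hrep hk h9
        (fun a x => if h : a < q ∧ x < q then
          (M.updateRow k' r).adjugate ⟨x, h.2⟩ ⟨a, h.1⟩ else 0) ?_ ?_ ?_) le_rfl ?_)
      · intro a ha hak x hx
        rw [dif_pos ⟨ha, hx⟩, h1, hadj ⟨a, ha⟩ ⟨x, hx⟩, hadj k' ⟨x, hx⟩, hvF k', hvF ⟨a, ha⟩, h10,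
          ← hMd, ← det_mul_adjugate_updateRow M r hvk (k := ⟨a, ha⟩)
            (fun h0 => hak (congrArg Fin.val h0))]
        -- The numerator is `det M` times an integer, so the integer quotient is exact.
        exact Int.mul_ediv_cancel_left _ hM0
      · intro x hx
        rw [dif_pos ⟨hk, hx⟩, h1, hadj k' ⟨x, hx⟩]
        exact (adjugate_updateRow_self M r k' _).symm
      · intro a ha x hx
        rw [dif_pos ⟨ha, hx⟩]
        refine (abs_adjugate_le _ hB (fun c d => ?_) _ _).trans hAL
        rw [Matrix.updateRow_apply]
        split_ifs
        exacts [hw i hi d d.2, hMB c d]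
      · intro s₂ hF₂ hb₂ hN
        have h9₂ : s₂.var 9 = k + 1 := by rw [hF₂.1 9 (by decide), h9]
        have h3₂ : s₂.arr 3 = s₁.arr 3 := hF₂.2 3 (by decide)
        have h2₂ : s₂.arr 2 = s.arr 2 := by rw [hF₂.2 2 (by decide), h2]
        refine Runs.seq (Runs.assign hL (by decide) (by simpa [Exp.eval] using hb₂.2 3 _)
          (Runs.write hL (by decide) (by decide) ?_ ?_))
        · simp only [Exp.eval, abs_one]
          exact one_le_pow₀ (by norm_num)
        · refine ⟨M.updateRow k' r, ?_, ?_, ?_, ?_, ?_⟩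
          · intro c d
            rw [Matrix.updateRow_apply]
            split_ifs
            exacts [hw i hi d d.2, hMB c d]
          · rw [det_updateRow_eq_sum, ← hvF k']
            simp [Exp.eval, h9₂, h3₂, k']
          · rw [det_updateRow_eq_sum]; exact hvk
          · intro a x
            have := hN a a.2 x x.2
            rw [dif_pos ⟨a.2, x.2⟩] at this
            simpa using this
          · intro a
            have hidx : ∀ v, Exp.eval (s₂.setVar 10 v) (.sub (.var 9) (.const 1)) = k := fun v => by
              simp [Exp.eval, h9₂]
            have hcell : ∀ v, ((s₂.setVar 10 v).setArr 2 (k : ℤ) 1).arr 2 (a : ℕ) =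
                if a = k' then 1 else s.arr 2 (a : ℕ) := fun v => by
              simp [h2₂, Fin.ext_iff, k']
            rw [hidx, Exp.eval, hcell]
            by_cases hak : a = k'
            · subst hak
              exact Or.inr ⟨by simp, i, hi, fun x => by simp [hr]⟩
            · rw [if_neg hak]
              rcases hfl a with ⟨h0, hsol⟩ | ⟨h0, i', hi', hrow⟩
              · refine Or.inl ⟨h0, fun i' hi' => ?_⟩
                -- After multiplication by `det M` the product with the new column is a combination
                -- of the products with the old columns `a` and `k'`. For an earlier equation both
                -- vanish, as both columns were free; for the current one the two terms cancel.
                refine (mul_eq_zero.1 (?_ : M.det * _ = 0)).resolve_left hM0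
                rw [Finset.mul_sum]
                have hterm : ∀ x : Fin q,
                    M.det * (w i' x * (M.updateRow k' r).adjugate x a) =
                    (∑ y, r y * M.adjugate y k') * (w i' x * M.adjugate x a) -
                    (∑ y, r y * M.adjugate y a) * (w i' x * M.adjugate x k') := fun x => by
                  rw [mul_left_comm, det_mul_adjugate_updateRow M r hvk hak x]
                  ring
                rw [Finset.sum_congr rfl fun x _ => hterm x, Finset.sum_sub_distrib,
                  ← Finset.mul_sum, ← Finset.mul_sum]
                rcases Nat.lt_succ_iff_lt_or_eq.1 hi' with hlt | rfl
                · have hk0 : ∑ x : Fin q, w i' x * M.adjugate x k' = 0 := by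
                    rcases hfl k' with ⟨-, hs⟩ | ⟨h1', -⟩
                    · exact hs i' hlt
                    · exact absurd (hk2.symm.trans h1') (by norm_num)
                  rw [hsol i' hlt, hk0]; ring
                · change _ * (∑ y, r y * M.adjugate y a) - _ * (∑ y, r y * M.adjugate y k') = 0
                  ring
              · exact Or.inr ⟨h0, i', hi', fun x => by rw [Matrix.updateRow_ne hak, hrow]⟩
    -- No pivot: each free column already solves the current equation.
    · refine (Runs.skip ?_).mono (by omega) fun _ _ _ h => h
      refine ⟨M, hMB, by rw [h10, hMd], hM0, by rw [h1]; exact hadj, fun k => ?_⟩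
      rw [h2]
      refine (hfl k).imp_left fun ⟨h0, hsol⟩ => ⟨h0, fun i' hi' => ?_⟩
      rcases Nat.lt_succ_iff_lt_or_eq.1 hi' with hlt | rfl
      · exact hsol i' hlt
      · rcases hpiv with ⟨-, hz⟩ | ⟨k, hk, h9, -, -⟩
        · rw [← hsum]; exact hz k k.2 h0
        · refine absurd ?_ hc
          simp only [Exp.eval, h9]
          positivity

open Exp Prog in
/-- Array `1` becomes the identity matrix. -/
def identProg : Prog :=
  seq (forLoop 6 13 (write 1 (add (mul (var 6) (var 13)) (var 6)) (const 1))) (assign 10 (const 1))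

theorem mul_add_inj {q a x b y : ℕ} (hx : x < q) (hy : y < q) (h : a * q + x = b * q + y) :
    a = b ∧ x = y := by
  have hq : 0 < q := by omega
  have e₁ := congrArg (· / q) h
  have e₂ := congrArg (· % q) h
  simp only [mul_comm _ q, Nat.mul_add_div hq, Nat.div_eq_of_lt hx, Nat.div_eq_of_lt hy,
    Nat.mul_add_mod, Nat.mod_eq_of_lt hx, Nat.mod_eq_of_lt hy] at e₁ e₂
  omega

/-- The elimination starts from `M = 1`, its own adjugate, and the zero flags make every column
free. -/
theorem runs_identProg (hL : 1 ≤ L) (h13 : s.var 13 = q) (h1 : s.arr 1 = 0) (h2 : s.arr 2 = 0)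
    (hB : 1 ≤ B) : Runs L identProg s (q * (1 + 2) + 2 + 1) (ElimInv p q w B 0) := by
  intro hs
  have hq : (q : ℤ) ≤ 2 ^ L := by
    have := hs.1 13
    rw [h13] at this
    exact (le_abs_self _).trans this
  revert hs
  have h1L : |(1 : ℤ)| ≤ 2 ^ L := by rw [abs_one]; exact one_le_pow₀ (by norm_num)
  refine Runs.seq (Runs.mono (Runs.forLoop hL (T := 1) (fun n s' => ∀ a < q, ∀ x < q,
    s'.arr 1 ((a * q + x : ℕ) : ℤ) = if a = x ∧ a < n then 1 else 0) h13 hq (by decide) (by decide)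
    (by simp) (by simp [h1]) ?_) le_rfl ?_)
  · intro k hk s' hF h6 hI
    have h13' : s'.var 13 = q := by rw [hF.1 13 (by decide), h13]
    refine Runs.write hL (by decide) (by decide) h1L ?_
    intro a ha x hx
    simp only [Exp.eval, h6, h13', Store.arr_setArr, true_and]
    have hcast : (k : ℤ) * q + k = ((k * q + k : ℕ) : ℤ) := by push_cast; rfl
    simp only [hcast, Nat.cast_inj, hI a ha x hx]
    by_cases he : a * q + x = k * q + k
    · obtain ⟨rfl, rfl⟩ := mul_add_inj hx hk he
      simp
    · rw [if_neg he]
      have : ¬ (a = k ∧ x = k) := by rintro ⟨rfl, rfl⟩; exact he rfl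
      congr 1
      simp only [eq_iff_iff]; omega
  · intro s' hF _ hI
    refine Runs.assign hL (by decide) h1L ⟨1, ?_, by simp [Exp.eval], by simp, ?_, ?_⟩
    · intro a b
      rw [Matrix.one_apply]
      split_ifs <;> simp <;> omega
    · intro k x
      rw [Store.arr_setVar, hI k k.2 x x.2, Matrix.adjugate_one, Matrix.one_apply]
      simp [Fin.ext_iff, eq_comm]
    · intro k
      refine Or.inl ⟨?_, by simp⟩
      rw [Store.arr_setVar, hF.2 2 (by decide), h2]
      rfl

open Exp Prog in
/-- The list of the free columns. -/
def freeProg : Prog :=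
  seq (assign 11 (const 0)) (forLoop 6 13 (ite (sub (const 1) (read 2 (var 6)))
    (seq (write 4 (var 11) (var 6)) (assign 11 (add (var 11) (const 1)))) skip))

/-- The list is a bijection onto the free columns: soundness, completeness and injectivity. Freeness
reads `< 1`, the form in which the guard `1 - flag` provides it. -/
theorem runs_freeProg (hL : 1 ≤ L) (h13 : s.var 13 = q) :
    Runs L freeProg s (q * 5 + 3) fun s' => ∃ f : ℕ, s'.var 11 = f ∧ f ≤ q ∧
      (∀ y < f, ∃ k < q, s'.arr 4 (y : ℕ) = k ∧ s.arr 2 (k : ℕ) < 1) ∧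
      (∀ k < q, s.arr 2 (k : ℕ) < 1 → ∃ y < f, s'.arr 4 (y : ℕ) = k) ∧
      ∀ y < f, ∀ y' < f, s'.arr 4 (y : ℕ) = s'.arr 4 (y' : ℕ) → y = y' := by
  intro hs
  have hq : (q : ℤ) ≤ 2 ^ L := by
    have := hs.1 13
    rw [h13] at this
    exact (le_abs_self _).trans this
  revert hs
  have hT : q * 5 + 3 = 1 + (q * ((1 + (1 + 1)) + 2) + 2) := by ring
  rw [hT]
  refine Runs.seq (Runs.assign hL (by decide) (by simp [Exp.eval]) ?_)
  refine Runs.mono (Runs.forLoop hL (T := 1 + (1 + 1)) (fun n s' => ∃ f : ℕ, s'.var 11 = f ∧ f ≤ n ∧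
      (∀ y < f, ∃ k < n, s'.arr 4 (y : ℕ) = k ∧ s.arr 2 (k : ℕ) < 1) ∧
      (∀ k < n, s.arr 2 (k : ℕ) < 1 → ∃ y < f, s'.arr 4 (y : ℕ) = k) ∧
      ∀ y < f, ∀ y' < f, s'.arr 4 (y : ℕ) = s'.arr 4 (y' : ℕ) → y = y') (by simpa using h13) hq
      (by decide) (by decide) (by simp) ⟨0, by simp [Exp.eval]⟩ ?_) le_rfl fun _ _ _ h => h
  rintro k hk s' hF h6 ⟨f, h11, hf, hfree, hall, hinj⟩
  have h2 : s'.arr 2 = s.arr 2 := hF.2 2 (by decide)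
  refine Runs.ite hL (by decide) (fun hc => ?_) (fun hc => ?_)
  · simp only [Exp.eval, h6, h2] at hc
    have hcell : ∀ y : ℕ, ((s'.setArr 4 f k).setVar 11 (f + 1)).arr 4 (y : ℕ) =
        if y = f then (k : ℤ) else s'.arr 4 (y : ℕ) := by simp
    refine Runs.seq (Runs.write hL (by decide) (by decide) ?_ (Runs.assign hL (by decide) ?_ ?_))
    · simp only [Exp.eval, h6]
      rw [abs_of_nonneg (by positivity)]; omega
    · simp only [Exp.eval, Store.var_setArr, h11]
      rw [abs_of_nonneg (by positivity)]; omega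
    · simp only [Exp.eval, h6, h11, Store.var_setArr]
      refine ⟨f + 1, by simp, by omega, ?_, ?_, ?_⟩
      · intro y hy
        rw [hcell]
        split_ifs with hyf
        · exact ⟨k, by omega, rfl, by omega⟩
        · obtain ⟨j, hj, e⟩ := hfree y (by omega)
          exact ⟨j, by omega, e⟩
      · intro j hj hjfree
        rcases Nat.lt_succ_iff_lt_or_eq.1 hj with hlt | rfl
        · obtain ⟨y, hy, e⟩ := hall j hlt hjfree
          exact ⟨y, by omega, by rw [hcell, if_neg (by omega), e]⟩
        · exact ⟨f, by omega, by rw [hcell, if_pos rfl]⟩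
      · intro y hy y' hy' e
        rw [hcell, hcell] at e
        split_ifs at e with e₁ e₂ e₂
        · omega
        · obtain ⟨j, hj, e', -⟩ := hfree y' (by omega)
          omega
        · obtain ⟨j, hj, e', -⟩ := hfree y (by omega)
          omega
        · exact hinj y (by omega) y' (by omega) e
  · simp only [Exp.eval, h6, h2] at hc
    refine Runs.mono (T := 1) (Runs.skip ⟨f, h11, by omega, ?_, ?_, hinj⟩) (by omega)
      fun _ _ _ h => h
    · intro y hy
      obtain ⟨j, hj, e⟩ := hfree y hy
      exact ⟨j, by omega, e⟩
    · intro j hj hjfree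
      rcases Nat.lt_succ_iff_lt_or_eq.1 hj with hlt | rfl
      · exact hall j hlt hjfree
      · omega

/-- A basis of the kernel: vector `y` starts in array `1` at the address that is `q` times
cell `y` of array `4`. -/
def kernelProg : Prog :=
  .seq identProg (.seq (forLoop 5 12 stepProg) freeProg)

/-- The invariant after all `p` equations, together with the list of free columns, is
`IsKernelBasis`. The basis vectors stay where they are; array `4` points to them. -/
theorem runs_kernelProg (hL : 1 ≤ L) (h : Represents s p q w) (h1 : s.arr 1 = 0)
    (h2 : s.arr 2 = 0) (hB : 1 ≤ B) (hw : ∀ i < p, ∀ x < q, |w i x| ≤ B)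
    (hbd : (q + 1) * (B * (q.factorial * B ^ q)) ≤ 2 ^ L) :
    Runs L kernelProg s (p * (7 * q ^ 2 + 8 * q + 10) + 8 * q + 8) fun s' => ∃ f : ℕ,
      s'.var 11 = f ∧ f ≤ q ∧ IsKernelBasis (fun (i : Fin p) (x : Fin q) => w i x)
        (fun (y : Fin f) (x : Fin q) => s'.arr 1 (s'.arr 4 (y : ℕ) * q + (x : ℕ))) := by
  intro hs
  have hp : (p : ℤ) ≤ 2 ^ L := by
    have := hs.1 12
    rw [h.rows] at this
    exact (le_abs_self _).trans this
  revert hs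
  have hT : p * (7 * q ^ 2 + 8 * q + 10) + 8 * q + 8 = (q * (1 + 2) + 2 + 1) +
    ((p * ((q * (q * 3 + 8) + 3 + (1 + (q * q * 4 + 2 + (1 + 1)))) + 2) + 2) + (q * 5 + 3)) := by
    ring
  rw [hT]
  refine Runs.seq (Runs.mono (runs_identProg (p := p) (w := w) hL h.cols h1 h2 hB) le_rfl ?_)
  intro s₁ hF₁ _ hI₁
  have hr₁ : Represents s₁ p q w := h.frame hF₁
  refine Runs.seq (Runs.mono (Runs.forLoop hL
    (T := q * (q * 3 + 8) + 3 + (1 + (q * q * 4 + 2 + (1 + 1)))) (ElimInv p q w B) hr₁.rows hp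
    (by decide) (by decide) (fun i s' v h => h.of_agree (by simp) rfl rfl) hI₁ ?_) le_rfl ?_)
  · intro i hi s' hF h5 hI
    exact runs_stepProg hL (hr₁.frame hF) hi h5 hB hw hbd hI
  · rintro s₂ hF₂ - ⟨M, -, -, hM0, hadj, hfl⟩
    have hr₂ : Represents s₂ p q w := hr₁.frame hF₂
    refine Runs.mono (runs_freeProg hL hr₂.cols) le_rfl ?_
    rintro s₃ hF₃ - ⟨f, h11, hf, hfree, hall, hinj⟩
    have h1₃ : s₃.arr 1 = s₂.arr 1 := hF₃.2 1 (by decide)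
    refine ⟨f, h11, hf, ?_⟩
    choose! e he₁ he₂ he₃ using hfree
    have hval : ∀ (y : Fin f) (x : Fin q), s₃.arr 1 (s₃.arr 4 (y : ℕ) * q + (x : ℕ)) =
        M.adjugate x ⟨e y, he₁ y y.2⟩ := by
      intro y x
      rw [← hadj ⟨e y, he₁ y y.2⟩ x, h1₃, he₂ y y.2]
      push_cast
      rfl
    refine ⟨M, fun y => ⟨e y, he₁ y y.2⟩, hM0, ?_, hval, ?_, ?_⟩
    · intro y y' hyy
      have : e y = e y' := congrArg Fin.val hyy
      exact Fin.ext (hinj y y.2 y' y'.2 (by rw [he₂ y y.2, he₂ y' y'.2, this]))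
    · intro k
      rcases hfl k with ⟨h0, -⟩ | ⟨-, i, hi, hrow⟩
      · obtain ⟨y, hy, hyk⟩ := hall k k.2 (by rw [h0]; norm_num)
        refine Or.inl ⟨⟨y, hy⟩, Fin.ext ?_⟩
        rw [he₂ y hy] at hyk
        exact_mod_cast hyk
      · exact Or.inr ⟨⟨i, hi⟩, funext hrow⟩
    · intro i y
      simp only [hval]
      rcases hfl ⟨e y, he₁ y y.2⟩ with ⟨-, hsol⟩ | ⟨h0, -⟩
      · exact hsol i i.2
      · have := he₃ y y.2
        simp only at h0
        omega

end

/-! ### Output of an integer matrix -/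

open Exp Prog in
/-- Append a letter to the output word. -/
def appendProg (e : Exp) : Prog := seq (write 0 (var 0) e) (assign 0 (add (var 0) (const 1)))

open Exp Prog in
/-- Write the code of the integer matrix with dimensions in variables `16` and `17`, whose entry in
row `5` and column `6` is `e`. -/
def emitProg (e : Exp) : Prog :=
  seq (assign 0 (const 0)) (seq (forLoop 5 16 (appendProg (const 1))) (seq (appendProg (const 0))
    (seq (forLoop 5 17 (appendProg (const 1))) (seq (appendProg (const 0))
      (forLoop 5 16 (forLoop 6 17 (seq (appendProg e) (appendProg (const 1)))))))))

section

variable {L : ℕ} {s : Store}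

theorem Store.Outputs.setVar {w : List ℤ} (h : s.Outputs w) {x : ℕ} (hx : x ≠ 0) (v : ℤ) :
    (s.setVar x v).Outputs w := by
  refine ⟨?_, h.2⟩
  rw [Store.var_setVar, if_neg hx.symm, h.1]

theorem runs_appendProg (hL : 1 ≤ L) {w : List ℤ} {e : Exp} (h : s.Outputs w)
    (he : e.weight ≤ maxWeight) (hb : |e.eval s| ≤ 2 ^ L) (hw : (w.length : ℤ) + 1 ≤ 2 ^ L) :
    Runs L (appendProg e) s (1 + 1) fun s' => s'.Outputs (w ++ [e.eval s]) := by
  refine Runs.seq (Runs.write hL (by decide) he hb (Runs.assign hL (by decide) ?_ ?_))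
  · simp only [Exp.eval, Store.var_setArr, h.1]
    rwa [abs_of_nonneg (by positivity)]
  · refine ⟨by simp [Exp.eval, h.1], fun j hj => ?_⟩
    simp only [List.length_append, List.length_singleton] at hj
    simp only [Exp.eval, Store.arr_setVar, Store.arr_setArr, h.1, true_and, Nat.cast_inj]
    split_ifs with hjw
    · simp [hjw]
    · rw [h.2 j (by omega), List.getD_append _ _ _ _ (by omega)]

theorem runs_forLoop_outputs (hL : 1 ≤ L) {x y : ℕ} {c : Prog} {T n : ℕ} (w : List ℤ)
    (g : ℕ → List ℤ) (hn : s.var y = n) (hnL : (n : ℤ) ≤ 2 ^ L) (hx : x ∉ c.modVars)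
    (hy : y ∉ x :: c.modVars) (hx0 : x ≠ 0) (h0 : s.Outputs w)
    (hc : ∀ i < n, ∀ s', (forLoop x y c).Frame s s' → s'.var x = i →
      s'.Outputs (w ++ (List.range i).flatMap g) →
      Runs L c s' T fun s'' => s''.Outputs (w ++ (List.range i).flatMap g ++ g i)) :
    Runs L (forLoop x y c) s (n * (T + 2) + 2)
      fun s' => s'.Outputs (w ++ (List.range n).flatMap g) := by
  refine Runs.forLoop hL (fun i s' => s'.Outputs (w ++ (List.range i).flatMap g)) hn hnL hx hy
    (fun i s' v h => h.setVar hx0 v) (by simpa using h0) ?_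
  intro i hi s' hF hxi hI
  refine Runs.mono (hc i hi s' hF hxi hI) le_rfl fun s'' _ _ h => ?_
  rw [List.range_succ, List.flatMap_append, List.flatMap_singleton, ← List.append_assoc]
  exact h

theorem flatMap_range_singleton (n : ℕ) (z : ℤ) :
    ((List.range n).flatMap fun _ => [z]) = List.replicate n z := by
  induction n with
  | zero => rfl
  | succ n ih => rw [List.range_succ, List.flatMap_append, ih, List.replicate_succ']; rfl

theorem runs_unaryProg (hL : 1 ≤ L) {y n : ℕ} (hy : y ∉ [5, 0]) {w : List ℤ} (hn : s.var y = n)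
    (h : s.Outputs w) (hw : (w.length : ℤ) + n ≤ 2 ^ L) :
    Runs L (forLoop 5 y (appendProg (.const 1))) s (n * ((1 + 1) + 2) + 2)
      fun s' => s'.Outputs (w ++ List.replicate n 1) := by
  rw [← flatMap_range_singleton]
  refine runs_forLoop_outputs hL w _ hn (by omega) (by decide) (by simpa [Prog.modVars, appendProg]
    using hy) (by decide) h ?_
  intro i hi s' _ _ h'
  refine runs_appendProg hL h' (by decide) ?_ ?_
  · simp only [Exp.eval, abs_one]; exact one_le_pow₀ (by norm_num)
  · rw [flatMap_range_singleton, List.length_append, List.length_replicate]; push_cast; omega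

/-- The code of an integer matrix. -/
def intCode (R C : ℕ) (E : ℕ → ℕ → ℤ) : List ℤ :=
  List.replicate R 1 ++ 0 :: (List.replicate C 1 ++ 0 ::
    (List.range R).flatMap fun a => (List.range C).flatMap fun b => [E a b, 1])

theorem flatMap_finRange (n : ℕ) (g : ℕ → List ℤ) :
    ((List.finRange n).flatMap fun i : Fin n => g i) = (List.range n).flatMap g := by
  rw [← List.map_coe_finRange_eq_range, List.flatMap_map]

theorem code_intMatrix (R C : ℕ) (E : ℕ → ℕ → ℤ) :
    RatMatrix.code ⟨R, C, Matrix.of fun a b => (E a b : ℚ)⟩ = intCode R C E := by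
  simp only [RatMatrix.code, intCode, Matrix.of_apply, Rat.num_intCast, Rat.den_intCast,
    Nat.cast_one]
  rw [← flatMap_finRange R]
  simp only [← flatMap_finRange C]

theorem length_flatMap_pairs (C : ℕ) (E : ℕ → ℤ) :
    ((List.range C).flatMap fun b => [E b, 1]).length = C * 2 := by
  simp [List.length_flatMap]

theorem length_flatMap_flatMap_pairs (R C : ℕ) (E : ℕ → ℕ → ℤ) :
    ((List.range R).flatMap fun a => (List.range C).flatMap fun b => [E a b, 1]).length =
      R * (C * 2) := by
  rw [List.length_flatMap]
  simp only [length_flatMap_pairs]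
  simp

/-- The output overwrites the input in array `0`, so `hE` asks for the value of `e` in every store
that differs from `s` only there and in the variables `0`, `5`, `6`. -/
theorem runs_emitProg (hL : 1 ≤ L) {e : Exp} (he : e.weight ≤ maxWeight) {R C : ℕ}
    (E : ℕ → ℕ → ℤ) (hR : s.var 16 = R) (hC : s.var 17 = C)
    (hE : ∀ s' : Store, (∀ x, x ∉ [0, 5, 6] → s'.var x = s.var x) →
      (∀ a, a ≠ 0 → s'.arr a = s.arr a) → ∀ a < R, ∀ b < C, s'.var 5 = a → s'.var 6 = b →
      e.eval s' = E a b) (hEb : ∀ a < R, ∀ b < C, |E a b| ≤ 2 ^ L)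
    (hlen : (R : ℤ) + C + 2 + R * (C * 2) ≤ 2 ^ L) :
    Runs L (emitProg e) s (6 * R * C + 8 * R + 4 * C + 11)
      fun s' => s'.Outputs (intCode R C E) := by
  have hRC : (0 : ℤ) ≤ R * (C * 2) := by positivity
  have h1L : |(1 : ℤ)| ≤ 2 ^ L := by rw [abs_one]; exact one_le_pow₀ (by norm_num)
  have h0L : |(0 : ℤ)| ≤ 2 ^ L := by rw [abs_zero]; positivity
  have hT : 6 * R * C + 8 * R + 4 * C + 11 = 1 + ((R * ((1 + 1) + 2) + 2) + ((1 + 1) +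
      ((C * ((1 + 1) + 2) + 2) + ((1 + 1) +
      (R * ((C * (((1 + 1) + (1 + 1)) + 2) + 2) + 2) + 2))))) := by ring
  rw [hT]
  refine Runs.seq (Runs.assign hL (by decide) (by simp [Exp.eval]) ?_)
  refine Runs.seq (Runs.mono (runs_unaryProg hL (w := []) (by decide) (by simpa using hR)
    ⟨by simp [Exp.eval], by simp⟩ (by simp; omega)) le_rfl ?_)
  intro s₁ hF₁ _ h₁
  refine Runs.seq (Runs.mono (runs_appendProg hL h₁ (by decide) h0L (by simp; omega)) le_rfl ?_)
  intro s₂ hF₂ _ h₂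
  have hC₂ : s₂.var 17 = C := by
    rw [hF₂.1 17 (by decide), hF₁.1 17 (by decide)]; simpa using hC
  refine Runs.seq (Runs.mono (runs_unaryProg hL (by decide) hC₂ h₂ (by simp; omega)) le_rfl ?_)
  intro s₃ hF₃ _ h₃
  refine Runs.seq (Runs.mono (runs_appendProg hL h₃ (by decide) h0L (by simp; omega)) le_rfl ?_)
  intro s₄ hF₄ _ h₄
  have hv₄ : ∀ x, x ∉ [0, 5] → s₄.var x = s.var x := by
    intro x hx
    simp only [List.mem_cons, List.not_mem_nil, or_false, not_or] at hx
    rw [hF₄.1 x, hF₃.1 x, hF₂.1 x, hF₁.1 x, Store.var_setVar, if_neg hx.1] <;>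
      simp [forLoop, appendProg, Prog.modVars, hx]
  have ha₄ : ∀ a, a ≠ 0 → s₄.arr a = s.arr a := by
    intro a ha
    rw [hF₄.2 a, hF₃.2 a, hF₂.2 a, hF₁.2 a, Store.arr_setVar] <;>
      simp [forLoop, appendProg, Prog.modArrs, ha]
  set w : List ℤ := [] ++ List.replicate R 1 ++ [0] ++ List.replicate C 1 ++ [0] with hw
  have hwl : (w.length : ℤ) = R + C + 2 := by simp [hw]; ring
  have hcode : intCode R C E = w ++ (List.range R).flatMap
      fun a => (List.range C).flatMap fun b => [E a b, 1] := by simp [hw, intCode]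
  rw [hcode]
  refine runs_forLoop_outputs hL w _ (by rw [hv₄ 16 (by decide), hR]) (by omega)
    (by simp [forLoop, appendProg, Prog.modVars]) (by simp [forLoop, appendProg, Prog.modVars])
    (by decide) h₄ ?_
  intro a ha s₅ hF₅ h5 h₅
  refine runs_forLoop_outputs hL (T := (1 + 1) + (1 + 1)) _ _ (n := C) ?_ (by omega)
    (by simp [appendProg, Prog.modVars]) (by simp [appendProg, Prog.modVars]) (by decide) h₅ ?_
  · rw [hF₅.1 17 (by simp [forLoop, appendProg, Prog.modVars]), hv₄ 17 (by decide), hC]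
  intro b hb s₆ hF₆ h6 h₆
  have hlen' : ((w ++ (List.range a).flatMap (fun a => (List.range C).flatMap fun b => [E a b, 1]) ++
      (List.range b).flatMap fun b => [E a b, 1]).length : ℤ) + 2 ≤ 2 ^ L := by
    rw [List.length_append, List.length_append, length_flatMap_flatMap_pairs, length_flatMap_pairs]
    push_cast
    rw [hwl]
    have : (a : ℤ) * (C * 2) + C * 2 ≤ R * (C * 2) := by
      have : (a : ℤ) + 1 ≤ R := by exact_mod_cast ha
      nlinarith
    have : (b : ℤ) + 1 ≤ C := by exact_mod_cast hb
    linarith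
  have hev : e.eval s₆ = E a b := by
    refine hE s₆ (fun x hx => ?_) (fun x hx => ?_) a ha b hb ?_ h6
    · simp only [List.mem_cons, List.not_mem_nil, or_false, not_or] at hx
      rw [hF₆.1 x, hF₅.1 x, hv₄ x] <;> simp [forLoop, appendProg, Prog.modVars, hx]
    · rw [hF₆.2 x, hF₅.2 x, ha₄ x hx] <;> simp [forLoop, appendProg, Prog.modArrs, hx]
    · rw [hF₆.1 5, h5]; simp [forLoop, appendProg, Prog.modVars]
  refine Runs.seq (Runs.mono (runs_appendProg hL h₆ he (by rw [hev]; exact hEb a ha b hb)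
    (by omega)) le_rfl ?_)
  intro s₇ _ _ h₇
  refine Runs.mono (runs_appendProg hL h₇ (by decide) h1L ?_) le_rfl ?_
  · rw [List.length_append, List.length_singleton]; push_cast; omega
  · intro s₈ _ _ h₈
    rw [hev] at h₈
    simpa [Exp.eval] using h₈

end

/-! ### Input of a rational matrix -/

theorem getD_flatMap {ι : Type} {k : ℕ} (f : ι → List ℤ) (hf : ∀ i, (f i).length = k) (l : List ι)
    {i r : ℕ} (hi : i < l.length) (hr : r < k) :
    (l.flatMap f).getD (i * k + r) 0 = (f l[i]).getD r 0 := by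
  induction l generalizing i with
  | nil => simp at hi
  | cons a l ih =>
    rw [List.flatMap_cons]
    cases i with
    | zero =>
      rw [List.getD_append _ _ _ _ (by rw [hf]; omega)]
      simp
    | succ i =>
      have : (i + 1) * k + r = k + (i * k + r) := by ring
      rw [List.getD_append_right _ _ _ _ (by rw [hf, this]; omega), hf, this, Nat.add_sub_cancel_left,
        ih (by simpa using hi)]
      simp

namespace RatMatrix

variable (A : RatMatrix)

theorem getD_code_row {i : ℕ} (hi : i < A.rows) : A.code.getD i 0 = 1 := by
  rw [code, List.getD_append _ _ _ _ (by simpa using hi), List.getD_eq_getElem?_getD]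
  simp [hi]

theorem getD_code_rows : A.code.getD A.rows 0 = 0 := by
  rw [code, List.getD_append_right _ _ _ _ (by simp)]
  simp

theorem getD_code_add (i : ℕ) : A.code.getD (A.rows + 1 + i) 0 = (List.replicate A.cols 1 ++ 0 ::
    (List.finRange A.rows).flatMap fun i => (List.finRange A.cols).flatMap fun j =>
      [(A.entries i j).num, ((A.entries i j).den : ℤ)]).getD i 0 := by
  rw [code, List.getD_append_right _ _ _ _ (by simp; omega), List.length_replicate]
  have : A.rows + 1 + i - A.rows = i + 1 := by omega
  rw [this, List.getD_cons_succ]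

theorem getD_code_col {i : ℕ} (hi : i < A.cols) : A.code.getD (A.rows + 1 + i) 0 = 1 := by
  rw [getD_code_add, List.getD_append _ _ _ _ (by simpa using hi), List.getD_eq_getElem?_getD]
  simp [hi]

theorem getD_code_cols : A.code.getD (A.rows + 1 + A.cols) 0 = 0 := by
  rw [getD_code_add, List.getD_append_right _ _ _ _ (by simp)]
  simp

/-- The two unary blocks with their closing zeros take `rows + cols + 2` letters, and each entry
takes two. -/
theorem getD_code_entry (i : Fin A.rows) (j : Fin A.cols) {r : ℕ} (hr : r < 2) :
    A.code.getD (A.rows + A.cols + 2 + 2 * (i * A.cols + j) + r) 0 =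
      [(A.entries i j).num, ((A.entries i j).den : ℤ)].getD r 0 := by
  have e : A.rows + A.cols + 2 + 2 * (i * A.cols + j) + r =
      A.rows + 1 + (A.cols + (i * (A.cols * 2) + (j * 2 + r) + 1)) := by ring
  rw [e, getD_code_add, List.getD_append_right _ _ _ _ (by simp), List.length_replicate,
    Nat.add_sub_cancel_left, List.getD_cons_succ,
    getD_flatMap (k := A.cols * 2) _ (by simp [List.length_flatMap]) _ (by simp)
      (by have := j.2; omega),
    getD_flatMap (k := 2) _ (by simp) _ (by simp) hr]
  simp

theorem length_code : A.code.length = A.rows + A.cols + 2 + A.rows * (A.cols * 2) := by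
  simp [code, List.length_flatMap]
  ring

end RatMatrix

theorem length_le_wordSize (w : List ℤ) : w.length ≤ wordSize w := by
  induction w with
  | nil => simp
  | cons a w ih =>
    simp only [wordSize, List.map_cons, List.sum_cons, List.length_cons, bitLen] at *
    omega

theorem abs_le_two_pow_bitLen (z : ℤ) : |z| ≤ 2 ^ bitLen z := by
  rw [Int.abs_eq_natAbs]
  have h : z.natAbs < 2 ^ z.natAbs.size := Nat.lt_size_self _
  have h' : 2 ^ z.natAbs.size ≤ 2 ^ bitLen z := Nat.pow_le_pow_right (by norm_num) (Nat.le_succ _)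
  exact_mod_cast (h.le.trans h')

theorem abs_getD_le (w : List ℤ) (i : ℕ) : |w.getD i 0| ≤ 2 ^ wordSize w := by
  by_cases hi : i < w.length
  · rw [List.getD_eq_getElem _ _ hi]
    refine (abs_le_two_pow_bitLen _).trans (pow_le_pow_right₀ (by norm_num) ?_)
    exact List.le_sum_of_mem (List.mem_map_of_mem (List.getElem_mem hi))
  · rw [List.getD_eq_default _ _ (by omega)]
    simp

theorem bounded_init {ws : List (List ℤ)} {L : ℕ} (hL : (ws.map wordSize).sum ≤ L) :
    (Store.init ws).Bounded L := by
  have hw : ∀ i, wordSize (ws.getD i []) ≤ L := by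
    intro i
    by_cases hi : i < ws.length
    · rw [List.getD_eq_getElem _ _ hi]
      exact (List.le_sum_of_mem (List.mem_map_of_mem (List.getElem_mem hi))).trans hL
    · rw [List.getD_eq_default _ _ (by omega)]
      simp [wordSize]
  refine ⟨fun x => ?_, fun a i => ?_⟩
  · simp only [Store.init]
    rw [abs_of_nonneg (by positivity)]
    exact_mod_cast (length_le_wordSize _).trans ((hw x).trans Nat.lt_two_pow_self.le)
  · simp only [Store.init]
    split_ifs
    · exact (abs_getD_le _ _).trans (pow_le_pow_right₀ (by norm_num) (hw a))
    · simp

/-! ### Clearing denominators -/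

namespace RatMatrix

variable (A : RatMatrix)

/-- Numerator of the entry with flat index `x`. -/
def flatNum (x : ℕ) : ℤ := A.code.getD (A.rows + A.cols + 2 + 2 * x) 0

/-- Denominator of the entry with flat index `x`. -/
def flatDen (x : ℕ) : ℤ := A.code.getD (A.rows + A.cols + 2 + 2 * x + 1) 0

/-- The product of all denominators. -/
def denProd : ℤ := ∏ x ∈ Finset.range (A.rows * A.cols), A.flatDen x

/-- The entry with flat index `x`, multiplied by the product of all denominators. -/
def scaled (x : ℕ) : ℤ := A.flatNum x * A.denProd / A.flatDen x

theorem flatNum_eq (i : Fin A.rows) (j : Fin A.cols) :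
    A.flatNum (i * A.cols + j) = (A.entries i j).num :=
  A.getD_code_entry i j (r := 0) (by norm_num)

theorem flatDen_eq (i : Fin A.rows) (j : Fin A.cols) :
    A.flatDen (i * A.cols + j) = (A.entries i j).den :=
  A.getD_code_entry i j (r := 1) (by norm_num)

theorem flatIndex_lt {i j : ℕ} (hi : i < A.rows) (hj : j < A.cols) :
    i * A.cols + j < A.rows * A.cols := by nlinarith

theorem denProd_ne_zero : A.denProd ≠ 0 := by
  refine Finset.prod_ne_zero_iff.2 fun x hx => ?_
  rw [Finset.mem_range, mul_comm] at hx
  have hc : 0 < A.cols := Nat.pos_of_ne_zero fun h => by simp [h] at hx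
  have := A.flatDen_eq ⟨x / A.cols, Nat.div_lt_of_lt_mul hx⟩ ⟨x % A.cols, Nat.mod_lt _ hc⟩
  simp only [Nat.div_add_mod'] at this
  rw [this]
  exact_mod_cast (Rat.den_pos _).ne'

/-- Each denominator divides the product, so the integer division in `scaled` is exact. The plain
product needs no gcd computation and is still of polynomial length. -/
theorem entry_mul_denProd (i : Fin A.rows) (j : Fin A.cols) :
    A.entries i j * A.denProd = A.scaled (i * A.cols + j) := by
  have hdvd : ((A.entries i j).den : ℤ) ∣ A.denProd := by
    rw [← flatDen_eq]
    exact Finset.dvd_prod_of_mem _ (Finset.mem_range.2 (A.flatIndex_lt i.2 j.2))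
  have hden : ((A.entries i j).den : ℚ) ≠ 0 := by exact_mod_cast (Rat.den_pos _).ne'
  rw [scaled, flatNum_eq, flatDen_eq, Int.cast_div (Dvd.dvd.mul_left hdvd _)
    (by exact_mod_cast hden)]
  push_cast
  conv_lhs => rw [← Rat.num_div_den (A.entries i j)]
  ring

theorem dims_le_wordSize : A.rows + A.cols + 2 + A.rows * (A.cols * 2) ≤ wordSize A.code := by
  rw [← length_code]
  exact length_le_wordSize _

/-- There are at most `wordSize` factors of at most `2 ^ wordSize` each. All prefixes are covered,
since the program passes through them. -/
theorem abs_prod_flatDen_le {x : ℕ} (hx : x ≤ A.rows * A.cols) :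
    |∏ y ∈ Finset.range x, A.flatDen y| ≤ 2 ^ (wordSize A.code * wordSize A.code) := by
  rw [Finset.abs_prod]
  calc ∏ y ∈ Finset.range x, |A.flatDen y| ≤ ∏ _y ∈ Finset.range x, 2 ^ wordSize A.code :=
        Finset.prod_le_prod (fun _ _ => abs_nonneg _) fun _ _ => abs_getD_le _ _
    _ = 2 ^ (wordSize A.code * x) := by rw [Finset.prod_const, Finset.card_range, ← pow_mul]
    _ ≤ _ := by
      have := A.dims_le_wordSize
      exact pow_le_pow_right₀ (by norm_num) (Nat.mul_le_mul_left _ (by nlinarith))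

theorem abs_scaled_le (x : ℕ) :
    |A.scaled x| ≤ 2 ^ (wordSize A.code + wordSize A.code * wordSize A.code) := by
  refine (abs_ediv_le_abs _ _).trans ?_
  rw [abs_mul, pow_add]
  exact mul_le_mul (abs_getD_le _ _) (A.abs_prod_flatDen_le le_rfl) (abs_nonneg _) (by positivity)

end RatMatrix

/-! ### Size estimates and the assembled program -/

theorem le_cube_of_le {S a b c d : ℕ} (ha : a ≤ 8) (hb : b ≤ 12) (hc : c ≤ 6) (hd : d ≤ 1) :
    a + b * S + c * S ^ 2 + d * S ^ 3 ≤ (S + 2) ^ 3 := by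
  have : (S + 2) ^ 3 = 8 + 12 * S + 6 * S ^ 2 + 1 * S ^ 3 := by ring
  rw [this]
  gcongr

/-- The factors contribute the exponents `S`, `S + S²`, `S²` and `(S + S²) S`; their sum `2 S + 3 S²
+ S³` lies coefficientwise below `(S + 2)³`. -/
theorem elim_bound {S q : ℕ} (hq : q + 1 ≤ S) :
    ((q : ℤ) + 1) * (2 ^ (S + S * S) * (q.factorial * (2 ^ (S + S * S)) ^ q)) ≤
      2 ^ ((S + 2) ^ 3) := by
  have hS : S ≤ 2 ^ S := Nat.lt_two_pow_self.le
  have hf : q.factorial ≤ 2 ^ (S * S) := by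
    calc q.factorial ≤ q ^ q := Nat.factorial_le_pow q
      _ ≤ (2 ^ S) ^ q := Nat.pow_le_pow_left (by omega) _
      _ = 2 ^ (S * q) := by rw [pow_mul]
      _ ≤ _ := Nat.pow_le_pow_right (by norm_num) (Nat.mul_le_mul_left _ (by omega))
  have hp : (2 ^ (S + S * S)) ^ q ≤ 2 ^ ((S + S * S) * S) := by
    rw [← pow_mul]
    exact Nat.pow_le_pow_right (by norm_num) (Nat.mul_le_mul_left _ (by omega))
  have : (q + 1) * (2 ^ (S + S * S) * (q.factorial * (2 ^ (S + S * S)) ^ q)) ≤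
      2 ^ ((S + 2) ^ 3) := by
    calc _ ≤ 2 ^ S * (2 ^ (S + S * S) * (2 ^ (S * S) * 2 ^ ((S + S * S) * S))) := by
          gcongr
          omega
      _ = 2 ^ (0 + 2 * S + 3 * S ^ 2 + 1 * S ^ 3) := by
          rw [← pow_add, ← pow_add, ← pow_add]; ring_nf
      _ ≤ _ := Nat.pow_le_pow_right (by norm_num)
          (le_cube_of_le (by norm_num) (by norm_num) (by norm_num) (by norm_num))
  exact_mod_cast this

open Exp Prog in
/-- Read the dimensions of the input matrix and multiply the denominators. -/
def parseProg : Prog :=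
  seq (loop (read 0 (var 1)) (assign 1 (add (var 1) (const 1))))
    (seq (loop (read 0 (add (add (var 1) (const 1)) (var 2))) (assign 2 (add (var 2) (const 1))))
    (seq (assign 3 (add (add (var 1) (var 2)) (const 2)))
    (seq (assign 19 (mul (var 1) (var 2)))
    (seq (assign 4 (const 1))
    (forLoop 6 19 (assign 4 (mul (var 4)
      (read 0 (add (add (var 3) (mul (const 2) (var 6))) (const 1))))))))))

open Exp Prog in
/-- Choose the equations: their number, the number of unknowns, and the strides. -/
def setupProg (eP eQ a b : Exp) : Prog :=
  seq (assign 12 eP) (seq (assign 13 eQ) (seq (assign 14 a) (seq (assign 15 b)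
    (assign 18 (mul (var 13) (var 13))))))

open Exp Prog in
/-- Read a matrix, compute a basis of the kernel of the chosen equations, and write a matrix of
dimensions `eR` and `eC` with entries `e`. -/
def nullProg (eP eQ a b eR eC e : Exp) : Prog :=
  seq parseProg (seq (setupProg eP eQ a b) (seq kernelProg
    (seq (assign 16 eR) (seq (assign 17 eC) (emitProg e)))))

section

variable {L : ℕ} {s : Store}

theorem abs_natCast_le_two_pow {n L : ℕ} (h : n ≤ L) : |(n : ℤ)| ≤ 2 ^ L := by
  rw [abs_of_nonneg (by positivity)]
  exact_mod_cast h.trans Nat.lt_two_pow_self.le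

/-- The unary letters `1` act as positive loop guards and the closing `0` ends the loop. -/
theorem runs_parseProg (hL : 1 ≤ L) (A : RatMatrix) (h0 : ∀ i : ℕ, s.arr 0 i = A.code.getD i 0)
    (h1 : s.var 1 = 0) (h2 : s.var 2 = 0)
    (hlen : A.rows + A.cols + 2 + A.rows * (A.cols * 2) ≤ L)
    (hD : ∀ x ≤ A.rows * A.cols, |∏ y ∈ Finset.range x, A.flatDen y| ≤ 2 ^ L) :
    Runs L parseProg s (2 * A.rows + 2 * A.cols + 3 * (A.rows * A.cols) + 7) fun s' =>
      s'.var 1 = A.rows ∧ s'.var 2 = A.cols ∧ s'.var 3 = (A.rows + A.cols + 2 : ℕ) ∧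
      s'.var 4 = A.denProd := by
  have hmn : A.rows * A.cols ≤ L := by nlinarith
  have hT : 2 * A.rows + 2 * A.cols + 3 * (A.rows * A.cols) + 7 = (A.rows * (1 + 1) + 1) +
      ((A.cols * (1 + 1) + 1) + (1 + (1 + (1 + (A.rows * A.cols * (1 + 2) + 2))))) := by ring
  rw [hT]
  refine Runs.seq (Runs.mono (Runs.loop hL (T := 1) (n := A.rows)
    (fun i s' => s'.var 1 = i) (by decide) (by simpa using h1) ?_ ?_) le_rfl ?_)
  · intro i hi s' hF h1'
    have h0' : s'.arr 0 = s.arr 0 := hF.2 0 (by decide)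
    refine ⟨?_, Runs.assign hL (by decide) ?_ (by simp [Exp.eval, h1'])⟩
    · simp only [Exp.eval, h1', h0', h0, A.getD_code_row hi]
      norm_num
    · simp only [Exp.eval, h1']
      exact_mod_cast abs_natCast_le_two_pow (show i + 1 ≤ L by omega)
  · intro s' hF h1'
    have h0' : s'.arr 0 = s.arr 0 := hF.2 0 (by decide)
    simp only [Exp.eval, h1', h0', h0, A.getD_code_rows]
    norm_num
  intro s₁ hF₁ _ h1₁
  have h0₁ : ∀ i : ℕ, s₁.arr 0 i = A.code.getD i 0 := by rw [hF₁.2 0 (by decide)]; exact h0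
  have h2₁ : s₁.var 2 = 0 := by rw [hF₁.1 2 (by decide), h2]
  refine Runs.seq (Runs.mono (Runs.loop hL (T := 1) (n := A.cols)
    (fun i s' => s'.var 2 = i) (by decide) (by simpa using h2₁) ?_ ?_) le_rfl ?_)
  · intro i hi s' hF h2'
    have h0' : s'.arr 0 = s₁.arr 0 := hF.2 0 (by decide)
    have h1' : s'.var 1 = A.rows := by rw [hF.1 1 (by decide), h1₁]
    refine ⟨?_, Runs.assign hL (by decide) ?_ (by simp [Exp.eval, h2'])⟩
    · have := h0₁ (A.rows + 1 + i)
      rw [A.getD_code_col hi] at this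
      push_cast at this
      simp only [Exp.eval, h1', h2', h0', this]
      norm_num
    · simp only [Exp.eval, h2']
      exact_mod_cast abs_natCast_le_two_pow (show i + 1 ≤ L by omega)
  · intro s' hF h2'
    have h0' : s'.arr 0 = s₁.arr 0 := hF.2 0 (by decide)
    have h1' : s'.var 1 = A.rows := by rw [hF.1 1 (by decide), h1₁]
    have := h0₁ (A.rows + 1 + A.cols)
    rw [A.getD_code_cols] at this
    push_cast at this
    simp only [Exp.eval, h1', h2', h0', this]
    norm_num
  intro s₂ hF₂ _ h2₂
  have h0₂ : ∀ i : ℕ, s₂.arr 0 i = A.code.getD i 0 := by rw [hF₂.2 0 (by decide)]; exact h0₁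
  have h1₂ : s₂.var 1 = A.rows := by rw [hF₂.1 1 (by decide), h1₁]
  refine Runs.seq (Runs.assign hL (by decide) ?_ (Runs.seq (Runs.assign hL (by decide) ?_
    (Runs.seq (Runs.assign hL (by decide) ?_ (Runs.mono (Runs.forLoop hL (T := 1)
      (n := A.rows * A.cols) (fun x s' => s'.var 4 = ∏ y ∈ Finset.range x, A.flatDen y) ?_ ?_
      (by decide) (by decide) (by simp) (by simp [Exp.eval]) ?_) le_rfl ?_))))))
  · simp only [Exp.eval, h1₂, h2₂]
    exact_mod_cast abs_natCast_le_two_pow (show A.rows + A.cols + 2 ≤ L by omega)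
  · simp only [Exp.eval, Store.var_setVar, h1₂, h2₂]
    exact_mod_cast abs_natCast_le_two_pow hmn
  · simp only [Exp.eval, abs_one]; exact one_le_pow₀ (by norm_num)
  · simp [Exp.eval, h1₂, h2₂]
  · exact (le_abs_self _).trans (abs_natCast_le_two_pow hmn)
  · intro x hx s' hF h6 h4
    have h0' : s'.arr 0 = s₂.arr 0 := by rw [hF.2 0 (by decide)]; rfl
    have h3' : s'.var 3 = (A.rows + A.cols + 2 : ℕ) := by
      rw [hF.1 3 (by decide)]; simp [Exp.eval, h1₂, h2₂]
    have hev : Exp.eval s' (.mul (.var 4) (.read 0 (.add (.add (.var 3) (.mul (.const 2) (.var 6)))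
        (.const 1)))) = ∏ y ∈ Finset.range (x + 1), A.flatDen y := by
      rw [Finset.prod_range_succ, RatMatrix.flatDen, ← h0₂]
      simp only [Exp.eval, h4, h0', h3', h6]
      push_cast
      rfl
    refine Runs.assign hL (by decide) ?_ ?_
    · rw [hev]; exact hD _ hx
    · simp only [Store.var_setVar, if_true, hev]
  · intro s' hF _ h4
    refine ⟨?_, ?_, ?_, h4⟩
    · rw [hF.1 1 (by decide)]; simp [h1₂]
    · rw [hF.1 2 (by decide)]; simp [h2₂]
    · rw [hF.1 3 (by decide)]; simp [Exp.eval, h1₂, h2₂]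

/-- The strides let one program treat `A` and its transpose: `(cols, 1)` makes the rows of `A` the
equations, `(1, cols)` its columns. The hypothesis `he` ranges over stores because the expressions
are evaluated after earlier assignments. -/
theorem runs_setupProg (hL : 1 ≤ L) {A : RatMatrix} {eP eQ a b : Exp} {p q α β : ℕ}
    (h0 : ∀ i : ℕ, s.arr 0 i = A.code.getD i 0) (h1 : s.var 1 = A.rows) (h2 : s.var 2 = A.cols)
    (h3 : s.var 3 = (A.rows + A.cols + 2 : ℕ)) (h4 : s.var 4 = A.denProd)
    (he : ∀ s' : Store, s'.var 1 = A.rows → s'.var 2 = A.cols →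
      eP.eval s' = p ∧ eQ.eval s' = q ∧ a.eval s' = α ∧ b.eval s' = β)
    (hwt : eP.weight ≤ maxWeight ∧ eQ.weight ≤ maxWeight ∧ a.weight ≤ maxWeight ∧
      b.weight ≤ maxWeight) (hp : p ≤ L) (hq : q * q ≤ L) (hα : α ≤ L) (hβ : β ≤ L) :
    Runs L (setupProg eP eQ a b) s 5 fun s' =>
      Represents s' p q fun i j => A.scaled (i * α + j * β) := by
  have hqL : q ≤ L := (Nat.le_mul_self q).trans hq
  have e₁ := (he s h1 h2).1
  have e₂ := (he (s.setVar 12 p) (by simpa using h1) (by simpa using h2)).2.1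
  have e₃ := (he ((s.setVar 12 p).setVar 13 q) (by simpa using h1) (by simpa using h2)).2.2.1
  have e₄ := (he (((s.setVar 12 p).setVar 13 q).setVar 14 α) (by simpa using h1)
    (by simpa using h2)).2.2.2
  refine Runs.seq (T₁ := 1) (T₂ := 4) (Runs.assign hL hwt.1 ?_ ?_)
  · rw [e₁]; exact abs_natCast_le_two_pow hp
  rw [e₁]
  refine Runs.seq (T₁ := 1) (T₂ := 3) (Runs.assign hL hwt.2.1 ?_ ?_)
  · rw [e₂]; exact abs_natCast_le_two_pow hqL
  rw [e₂]
  refine Runs.seq (T₁ := 1) (T₂ := 2) (Runs.assign hL hwt.2.2.1 ?_ ?_)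
  · rw [e₃]; exact abs_natCast_le_two_pow hα
  rw [e₃]
  refine Runs.seq (T₁ := 1) (T₂ := 1) (Runs.assign hL hwt.2.2.2 ?_ ?_)
  · rw [e₄]; exact abs_natCast_le_two_pow hβ
  rw [e₄]
  refine Runs.assign hL (by decide) ?_ ?_
  · have := abs_natCast_le_two_pow hq
    push_cast at this
    simpa [Exp.eval] using this
  · refine ⟨by simp, by simp, by simp [Exp.eval], fun i hi j hj => ?_⟩
    simp only [Store.var_setVar, Store.arr_setVar, Nat.reduceEqDiff, if_true,
      if_false, h3, h4, RatMatrix.scaled, RatMatrix.flatNum, RatMatrix.flatDen, ← h0]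
    push_cast
    rfl

end

/-- The functions `idx` and `crd` tell which basis vector and which coordinate an output entry
shows, so the basis can be written as columns or as rows. -/
theorem runs_nullProg (A : RatMatrix) {S L : ℕ} (hS : S = wordSize A.code) (hLS : L = (S + 2) ^ 3)
    {eP eQ a b eR eC e : Exp} {p q α β : ℕ} (R C : ℕ → ℕ) (idx : ℕ → ℕ → ℕ) (crd : ℕ → ℕ → ℕ)
    (he : ∀ s' : Store, s'.var 1 = A.rows → s'.var 2 = A.cols →
      eP.eval s' = p ∧ eQ.eval s' = q ∧ a.eval s' = α ∧ b.eval s' = β)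
    (hwt : eP.weight ≤ maxWeight ∧ eQ.weight ≤ maxWeight ∧ a.weight ≤ maxWeight ∧
      b.weight ≤ maxWeight ∧ eR.weight ≤ maxWeight ∧ eC.weight ≤ maxWeight ∧ e.weight ≤ maxWeight)
    (hp : p ≤ S) (hq : q + 1 ≤ S) (hα : α ≤ S) (hβ : β ≤ S)
    (hRC : ∀ f ≤ q, R f ≤ S ∧ C f ≤ S)
    (heR : ∀ (s' : Store) (f : ℕ), s'.var 13 = q → s'.var 11 = f → eR.eval s' = R f ∧
      eC.eval s' = C f)
    (hent : ∀ s' : Store, s'.var 13 = q → ∀ i j : ℕ, s'.var 5 = i → s'.var 6 = j →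
      e.eval s' = s'.arr 1 (s'.arr 4 (idx i j) * q + crd i j)) :
    Runs L (nullProg eP eQ a b eR eC e) (Store.init [A.code]) (100 * (S + 1) ^ 3) fun s' =>
      ∃ (f : ℕ) (V : ℕ → ℕ → ℤ), IsKernelBasis
        (fun (i : Fin p) (j : Fin q) => A.scaled (i * α + j * β))
        (fun (y : Fin f) (x : Fin q) => V y x) ∧
        s'.Outputs (intCode (R f) (C f) fun i j => V (idx i j) (crd i j)) := by
  have hdim := A.dims_le_wordSize
  rw [← hS] at hdim
  have hL2 : ∀ {a b c d : ℕ}, a ≤ 8 → b ≤ 12 → c ≤ 6 → d ≤ 1 →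
      a + b * S + c * S ^ 2 + d * S ^ 3 ≤ L := by
    intro a b c d ha hb hc hd
    rw [hLS]; exact le_cube_of_le ha hb hc hd
  have hcube : L = 8 + 12 * S + 6 * S ^ 2 + S ^ 3 := by rw [hLS]; ring
  have hL : 1 ≤ L := by omega
  have hSL : S ≤ L := by omega
  have hS2L : S * S ≤ L := by rw [← sq]; omega
  have h0 : ∀ i : ℕ, (Store.init [A.code]).arr 0 i = A.code.getD i 0 := fun i => by
    simp [Store.init]
  have hmn : A.rows * A.cols ≤ S := by nlinarith
  have hT : (2 * A.rows + 2 * A.cols + 3 * (A.rows * A.cols) + 7) + (5 +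
      ((p * (7 * q ^ 2 + 8 * q + 10) + 8 * q + 8) + (1 + (1 +
        (6 * S * S + 8 * S + 4 * S + 11))))) ≤ 100 * (S + 1) ^ 3 := by
    have hr : A.rows ≤ S := by omega
    have hc : A.cols ≤ S := by omega
    have hq' : q ≤ S := by omega
    calc _ ≤ (2 * S + 2 * S + 3 * S + 7) + (5 +
      ((S * (7 * S ^ 2 + 8 * S + 10) + 8 * S + 8) + (1 + (1 +
        (6 * S * S + 8 * S + 4 * S + 11))))) := by gcongr
      _ = 33 + 37 * S + 14 * S ^ 2 + 7 * S ^ 3 := by ring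
      _ ≤ 100 + 300 * S + 300 * S ^ 2 + 100 * S ^ 3 := by gcongr <;> norm_num
      _ = _ := by ring
  -- There is a single input word, so every variable and array other than number `0` is initially
  -- zero.
  refine Runs.mono (Runs.seq (Runs.mono (runs_parseProg hL A h0 (by simp [Store.init])
    (by simp [Store.init]) (by omega) fun x hx => (A.abs_prod_flatDen_le hx).trans
      (pow_le_pow_right₀ (by norm_num) (by rw [← hS]; exact hS2L))) le_rfl ?_)) hT
      fun _ _ _ h => h
  rintro s₁ hF₁ - ⟨h1, h2, h3, h4⟩
  have h0₁ : ∀ i : ℕ, s₁.arr 0 i = A.code.getD i 0 := by rw [hF₁.2 0 (by decide)]; exact h0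
  have hq2 : q * q ≤ L := (Nat.mul_le_mul (by omega) (by omega)).trans hS2L
  refine Runs.seq (Runs.mono (runs_setupProg hL h0₁ h1 h2 h3 h4 he
    ⟨hwt.1, hwt.2.1, hwt.2.2.1, hwt.2.2.2.1⟩ (hp.trans hSL) hq2 (hα.trans hSL) (hβ.trans hSL))
    le_rfl ?_)
  intro s₂ hF₂ _ hrep
  have harr : ∀ a ∈ [1, 2], s₂.arr a = 0 := by
    intro a ha
    have ha' : a = 1 ∨ a = 2 := by simpa using ha
    rw [hF₂.2 a (by simp [setupProg, Prog.modArrs]), hF₁.2 a (by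
      rcases ha' with rfl | rfl <;> decide)]
    funext j
    rcases ha' with rfl | rfl <;> simp [Store.init]
  refine Runs.seq (Runs.mono (runs_kernelProg hL hrep (harr 1 (by simp)) (harr 2 (by simp))
    (B := 2 ^ (S + S * S)) (one_le_pow₀ (by norm_num))
    (fun i _ x _ => by rw [hS]; exact A.abs_scaled_le _) (by rw [hLS]; exact elim_bound hq))
    le_rfl ?_)
  rintro s₃ hF₃ hb₃ ⟨f, h11, hf, hV⟩
  have h13 : s₃.var 13 = q := by rw [hF₃.1 13 (by decide), hrep.cols]
  obtain ⟨hR, hC⟩ := hRC f hf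
  have e₁ := (heR s₃ f h13 h11).1
  have e₂ := (heR (s₃.setVar 16 (R f)) f (by simpa using h13) (by simpa using h11)).2
  refine Runs.seq (Runs.assign hL hwt.2.2.2.2.1 ?_ ?_)
  · rw [e₁]; exact abs_natCast_le_two_pow (hR.trans hSL)
  rw [e₁]
  refine Runs.seq (Runs.assign hL hwt.2.2.2.2.2.1 ?_ ?_)
  · rw [e₂]; exact abs_natCast_le_two_pow (hC.trans hSL)
  rw [e₂]
  refine Runs.mono (runs_emitProg hL hwt.2.2.2.2.2.2 (R := R f) (C := C f)
    (fun i j => s₃.arr 1 (s₃.arr 4 (idx i j) * q + crd i j)) (by simp) (by simp) ?_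
    (fun i _ j _ => hb₃.2 1 _) ?_) ?_ ?_
  · intro s' hv ha i _ j _ h5 h6
    rw [hent s' (by rw [hv 13 (by decide)]; simpa using h13) i j h5 h6, ha 1 (by decide),
      ha 4 (by decide)]
    rfl
  · have : R f + C f + 2 + R f * (C f * 2) ≤ L := by
      calc R f + C f + 2 + R f * (C f * 2) ≤ S + S + 2 + S * (S * 2) := by gcongr
        _ = 2 + 2 * S + 2 * S ^ 2 + 0 * S ^ 3 := by ring
        _ ≤ L := hL2 (by norm_num) (by norm_num) (by norm_num) (by norm_num)
    exact_mod_cast this.trans Nat.lt_two_pow_self.le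
  · gcongr
  · intro s₄ _ _ hout
    exact ⟨f, fun y x => s₃.arr 1 (s₃.arr 4 y * q + x), hV, hout⟩

/-! ### The reductions -/

/-- Cost polynomial for `T` steps in a memory bounded by `2 ^ L`. -/
noncomputable def costPoly (T L : Polynomial ℕ) : Polynomial ℕ :=
  T * (2 * (60 * (L * 60 + 2)) + 1)

theorem eval_costPoly (T L : Polynomial ℕ) (S : ℕ) :
    (costPoly T L).eval S = T.eval S * stepCost (L.eval S) := by
  simp [costPoly, stepCost]

open Exp in
/-- From the code of a matrix, compute the code of a full null matrix. -/
def nullMatrixProg : Prog :=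
  nullProg (var 1) (var 2) (var 2) (const 1) (var 13) (var 11)
    (read 1 (add (mul (read 4 (var 6)) (var 13)) (var 5)))

open Exp in
/-- From the code of a matrix, compute the code of a matrix whose null space is its column space. -/
def annihilatorProg : Prog :=
  nullProg (var 2) (var 1) (const 1) (var 2) (var 11) (var 13)
    (read 1 (add (mul (read 4 (var 5)) (var 13)) (var 6)))

/-- Cost bound of `nullProg`. -/
noncomputable def nullCost : Polynomial ℕ :=
  costPoly (100 * (Polynomial.X + 1) ^ 3) ((Polynomial.X + 2) ^ 3)

theorem eval_nullCost (S : ℕ) :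
    nullCost.eval S = 100 * (S + 1) ^ 3 * stepCost ((S + 2) ^ 3) := by
  rw [nullCost, eval_costPoly]
  simp

theorem exec_of_runs_nullProg {A : RatMatrix} {c : Prog} {Q : Store → Prop}
    (h : Runs ((wordSize A.code + 2) ^ 3) c (Store.init [A.code])
      (100 * (wordSize A.code + 1) ^ 3) Q) :
    ∃ s t, Exec c (Store.init [A.code]) s t ∧
      t ≤ nullCost.eval (([A.code].map wordSize).sum) ∧ Q s := by
  have hS : wordSize A.code ≤ (wordSize A.code + 2) ^ 3 :=
    (Nat.le_add_right _ 2).trans (Nat.le_self_pow (by norm_num) _)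
  obtain ⟨s, t, h₁, h₂, -, h₃⟩ := h (bounded_init (by simpa using hS))
  exact ⟨s, t, h₁, by simpa [eval_nullCost] using h₂, h₃⟩

theorem exec_nullMatrixProg (A : RatMatrix) : ∃ (N : RatMatrix) (s : Store) (t : ℕ),
    Exec nullMatrixProg (Store.init [A.code]) s t ∧
      t ≤ nullCost.eval (([A.code].map wordSize).sum) ∧ s.Outputs N.code ∧
      ∃ (k : ℕ) (N₀ : Matrix (Fin A.cols) (Fin k) ℚ),
        N = ⟨A.cols, k, N₀⟩ ∧ IsFullNullMatrix A.entries N₀ := by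
  have hdim := A.dims_le_wordSize
  obtain ⟨s, t, h₁, h₂, f, V, hV, hout⟩ := exec_of_runs_nullProg (c := nullMatrixProg)
    (runs_nullProg A rfl rfl (p := A.rows) (q := A.cols) (α := A.cols) (β := 1)
      (fun _ => A.cols) (fun f => f) (fun _ j => j) (fun i _ => i)
      (fun s' h₁ h₂ => by simp [Exp.eval, h₁, h₂]) (by decide) (by omega) (by omega) (by omega)
      (by omega) (fun f hf => ⟨by omega, by omega⟩)
      (fun s' f h₁ h₂ => by simp [Exp.eval, h₁, h₂])
      (fun s' h₁ i j h₂ h₃ => by simp [Exp.eval, h₁, h₂, h₃]))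
  refine ⟨_, s, t, h₁, h₂, by rw [code_intMatrix]; exact hout, f, _, rfl, ?_⟩
  exact hV.isFullNullMatrix (D := A.denProd) (by exact_mod_cast A.denProd_ne_zero)
    fun i x => by rw [A.entry_mul_denProd, mul_one]

/-- The columns of `A` are the equations. Full rank enters only in the last clause, so the program
and `N` make sense for every matrix. -/
theorem exec_annihilatorProg (A : RatMatrix) : ∃ (N : RatMatrix) (s : Store) (t : ℕ),
    Exec annihilatorProg (Store.init [A.code]) s t ∧
      t ≤ nullCost.eval (([A.code].map wordSize).sum) ∧ s.Outputs N.code ∧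
      ∃ (k : ℕ) (N₀ : Matrix (Fin k) (Fin A.rows) ℚ),
        N = ⟨k, A.rows, N₀⟩ ∧ (A.FullRank → IsFullNullMatrix N₀ A.entries) := by
  have hdim := A.dims_le_wordSize
  obtain ⟨s, t, h₁, h₂, f, V, hV, hout⟩ := exec_of_runs_nullProg (c := annihilatorProg)
    (runs_nullProg A rfl rfl (p := A.cols) (q := A.rows) (α := 1) (β := A.cols)
      (fun f => f) (fun _ => A.rows) (fun i _ => i) (fun _ j => j)
      (fun s' h₁ h₂ => by simp [Exp.eval, h₁, h₂]) (by decide) (by omega) (by omega) (by omega)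
      (by omega) (fun f hf => ⟨by omega, by omega⟩)
      (fun s' f h₁ h₂ => by simp [Exp.eval, h₁, h₂])
      (fun s' h₁ i j h₂ h₃ => by simp [Exp.eval, h₁, h₂, h₃]))
  refine ⟨_, s, t, h₁, h₂, by rw [code_intMatrix]; exact hout, f, _, rfl, fun hA => ?_⟩
  exact hV.isFullNullMatrix_transpose (D := A.denProd) (by exact_mod_cast A.denProd_ne_zero)
    (fun i x => by rw [A.entry_mul_denProd, mul_one, add_comm]) hA

open Exp Prog in
/-- Output the second input word. -/
def copyProg : Prog :=
  seq (assign 0 (var 1)) (forLoop 2 1 (write 0 (var 2) (read 1 (var 2))))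

theorem polyTime_snd {α β : Type} (enc₁ : α → List ℤ) (enc₂ : β → List ℤ) :
    PolyTime (fun p : α × β => [enc₁ p.1, enc₂ p.2]) enc₂ Prod.snd := by
  refine ⟨copyProg, costPoly (3 * Polynomial.X + 3) (Polynomial.X + 1), fun ⟨a, b⟩ => ?_⟩
  set ws := [enc₁ a, enc₂ b] with hws
  set S := (ws.map wordSize).sum with hS
  set s := Store.init ws with hs
  -- `S + 1` instead of `S`, because `S` may be `0` and the cost rules need `1 ≤ L`.
  have hb : s.Bounded (S + 1) := bounded_init (Nat.le_succ _)
  have hlen : (enc₂ b).length ≤ S := (length_le_wordSize _).trans (by simp [hS, hws])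
  have h1 : s.var 1 = (enc₂ b).length := by simp [hs, Store.init, hws]
  have harr : ∀ j : ℕ, s.arr 1 j = (enc₂ b).getD j 0 := fun j => by simp [hs, Store.init, hws]
  have hL : 1 ≤ S + 1 := by omega
  have hrun : Runs (S + 1) copyProg s (1 + ((enc₂ b).length * (1 + 2) + 2))
      fun s' => s'.Outputs (enc₂ b) := by
    refine Runs.seq (Runs.assign hL (by decide) (hb.1 1) (Runs.mono (Runs.forLoop hL (T := 1)
      (fun n s' => ∀ j < n, s'.arr 0 (j : ℕ) = (enc₂ b).getD j 0) (by simpa using h1) ?_ (by decide)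
      (by decide) (by simp) (by simp) ?_) le_rfl ?_))
    · exact (le_abs_self _).trans (abs_natCast_le_two_pow (by omega))
    · intro n hn s' hF h2 hI
      have h1' : s'.arr 1 = s.arr 1 := by rw [hF.2 1 (by decide)]; rfl
      refine Runs.write hL (by decide) (by decide) ?_ fun j hj => ?_
      · simp only [Exp.eval, h1']; exact hb.2 1 _
      · simp only [Exp.eval, h2, h1', harr, Store.arr_setArr, true_and, Nat.cast_inj]
        split_ifs with hjn
        · rw [hjn]
        · exact hI j (by omega)
    · intro s' hF _ hI
      refine ⟨?_, hI⟩
      rw [hF.1 0 (by decide)]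
      simp [Exp.eval, h1]
  obtain ⟨s', t, h₁, h₂, -, h₃⟩ := hrun hb
  refine ⟨s', t, h₁, h₂.trans ?_, h₃⟩
  rw [eval_costPoly]
  simp only [Polynomial.eval_add, Polynomial.eval_mul, Polynomial.eval_X, Polynomial.eval_ofNat,
    Polynomial.eval_one]
  exact Nat.mul_le_mul_right _ (by omega)

/-- If the solution spaces of `x` and of `t₁ x` coincide and so do the objectives, then `t₁` is
part of an exact reduction. -/
theorem exactlyReducible_of_solutions_eq {F G : MinProblem} (h : F.Sol = G.Sol) (t₁ : F.Inst → G.Inst)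
    (ht : PolyTime (fun x => [F.encInst x]) G.encInst t₁)
    (henc : ∀ y : F.Sol, F.encSol y = G.encSol (cast h y))
    (hS : ∀ x (y : F.Sol), y ∈ F.S x ↔ cast h y ∈ G.S (t₁ x))
    (hM : ∀ x (y : F.Sol), F.M x y = G.M (t₁ x) (cast h y)) : ExactlyReducible F G := by
  obtain ⟨Fi, Fs, Fe, Fe', i₁, i₂, FS, FM⟩ := F
  obtain ⟨Gi, Gs, Ge, Ge', j₁, j₂, GS, GM⟩ := G
  obtain rfl : Fs = Gs := h
  obtain rfl : Fe' = Ge' := funext henc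
  refine ⟨t₁, Prod.snd, ht, polyTime_snd Fe Fe', fun x y hy => (hS x y).2 hy,
    fun x y _ => hM x y, fun x => ?_⟩
  refine le_iInf₂ fun y hy => ?_
  rw [show ((FM x y : ℕ) : ℕ∞) = (GM (t₁ x) y : ℕ∞) from congrArg _ (hM x y)]
  exact iInf₂_le y ((hS x y).1 hy)

theorem matrixSparsification_reducible :
    ExactlyReducible matrixSparsification sparseNullSpace := by
  -- The program does not depend on the instance, so choosing its output for each instance defines a
  -- function that it computes.
  choose N s t h₁ h₂ h₃ k N₀ h₄ h₅ using exec_annihilatorProg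
  refine exactlyReducible_of_solutions_eq rfl (fun B => N B.1)
    ⟨annihilatorProg, nullCost, fun B => ⟨s B.1, t B.1, h₁ _, h₂ _, h₃ _⟩⟩ (fun _ => rfl) ?_
    fun _ _ => rfl
  rintro ⟨B, hB⟩ y
  have hfull := h₅ B hB
  change (∃ X : Matrix (Fin B.cols) (Fin B.cols) ℚ, IsUnit X ∧ y = ⟨B.rows, B.cols, B.entries * X⟩) ↔
    ∃ (l : ℕ) (Y : Matrix (Fin (N B).cols) (Fin l) ℚ), y = ⟨(N B).cols, l, Y⟩ ∧
      IsFullNullMatrix (N B).entries Y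
  rw [h₄ B]
  constructor
  · rintro ⟨X, hX, rfl⟩
    exact ⟨_, _, rfl, hfull.mul_isUnit hX⟩
  · rintro ⟨l, Y, rfl, hY⟩
    exact hfull.exists_eq_mul hY

theorem sparseNullSpace_reducible :
    ExactlyReducible sparseNullSpace matrixSparsification := by
  choose N s t h₁ h₂ h₃ k N₀ h₄ h₅ using exec_nullMatrixProg
  have hN : ∀ A, (N A).FullRank := fun A => by rw [h₄ A]; exact (h₅ A).1
  refine exactlyReducible_of_solutions_eq rfl (fun A => ⟨N A, hN A⟩)
    ⟨nullMatrixProg, nullCost, fun A => ⟨s A, t A, h₁ _, h₂ _, h₃ _⟩⟩ (fun _ => rfl) ?_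
    fun _ _ => rfl
  intro A y
  have hfull := h₅ A
  change (∃ (l : ℕ) (Y : Matrix (Fin A.cols) (Fin l) ℚ), y = ⟨A.cols, l, Y⟩ ∧
      IsFullNullMatrix A.entries Y) ↔
    ∃ X : Matrix (Fin (N A).cols) (Fin (N A).cols) ℚ,
      IsUnit X ∧ y = ⟨(N A).rows, (N A).cols, (N A).entries * X⟩
  rw [h₄ A]
  constructor
  · rintro ⟨l, Y, rfl, hY⟩
    exact hfull.exists_eq_mul hY
  · rintro ⟨X, hX, rfl⟩
    exact ⟨_, _, rfl, hfull.mul_isUnit hX⟩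

end SparseMat

theorem mainTheorem5 :
    SparseMat.Equivalent SparseMat.matrixSparsification SparseMat.sparseNullSpace :=
  ⟨SparseMat.matrixSparsification_reducible, SparseMat.sparseNullSpace_reducible⟩
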